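/- Let $d\ge 0$ and let $N=2d$ or $N=2d+1$. Identify polynomials of degree at most $N$ with their coefficient vectors in $\mathbb{R}^{N+1}$ with respect to the basis $T_0,\dots,T_N$ of Chebyshev polynomials of the first kind. Let $w_1=1$, $w_2=1-z^2$, $L_1=d+1$, $L_2=d$ if $N=2d$, and $w_1=1-z$, $w_2=1+z$, $L_1=L_2=d+1$ if $N=2d+1$. Let $\Sigma\subset\mathbb{R}^{N+1}$ be the cone of the polynomials $w_1\sigma_1+w_2\sigma_2$, where each $\sigma_i$ is a sum of squares of real polynomials of degree less than $L_i$ (so $\sigma_2=0$ if $L_2=0$), let $\Sigma^*=\{\mathbf{x}\in\mathbb{R}^{N+1} : \mathbf{s}^{\mathrm T}\mathbf{x}\ge 0 \ \forall\,\mathbf{s}\in\Sigma\}$ be its dual cone, and let $^\circ$ denote the interior. For $i=1,2$ let $\mathbf{p}_i$ be the column vector of an arbitrary ordered basis of the real polynomials of degree less than $L_i$, and let $\Lambda_i$ be the linear map from $\mathbb{R}^{N+1}$ to the symmetric $L_i\times L_i$ matrices with $\Lambda_i\big((T_0(z),\dots,T_N(z))\big)=w_i(z)\,\mathbf{p}_i(z)\mathbf{p}_i(z)^{\mathrm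 T}$ for all $z$. Let $H(\mathbf{x})$ be the Hessian at $\mathbf{x}\in(\Sigma^*)^\circ$ of the barrier function $f(\mathbf{x})=-\ln\det\big(\Lambda_1(\mathbf{x})\oplus\Lambda_2(\mathbf{x})\big)$. A vector $\mathbf{x}\in(\Sigma^*)^\circ$ is a dual certificate of $\mathbf{s}\in\Sigma$ if $H(\mathbf{x})^{-1}\mathbf{s}\in\Sigma^*$. The bit size of an integer $y$ is $1+\lceil\log_2(|y|+1)\rceil$. There is an absolute constant $C>0$ (independent of $d$, $N$, $\mathbf{p}_1$, $\mathbf{p}_2$, $\tau$ and $\mathbf{t}$) such that the following holds. If $\mathbf{t}\in\Sigma^\circ$ has integer components, each of bit size at most $\tau$, then $\mathbf{t}$ has an integer dual certificate $\overline{\mathbf{y}}\in(\Sigma^*)^\circ\cap\mathbb{Z}^{N+1}$ with \[ \log_2\|\overline{\mathbf{y}}\|_\infty \le C\,(d\tau+d^2), \] and, if $d\ge 1$, every component of $\overline{\mathbf{y}}$ has bit size at most $C\,(d\tau+d^2)$. -/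

import Mathlib

open Polynomial

noncomputable section

namespace DualCert

/-- The bit size `1 + ⌈log₂ (|y| + 1)⌉` of an integer `y`. -/
def bitSize (y : ℤ) : ℕ := 1 + ⌈Real.logb 2 (|(y : ℝ)| + 1)⌉₊

/-- The basis `T₀, T₁, T₂, …` of `ℝ[X]` formed by the Chebyshev polynomials of the first kind. -/
def chebBasis : Module.Basis ℕ ℝ ℝ[X] :=
  (Polynomial.Chebyshev.chebyshevTsequence ℝ).basis fun i =>
    isUnit_iff_ne_zero.mpr
      (leadingCoeff_ne_zero.mpr ((Polynomial.Chebyshev.chebyshevTsequence ℝ).ne_zero i))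

theorem chebBasis_apply (i : ℕ) : chebBasis i = Polynomial.Chebyshev.T ℝ (i : ℤ) := by
  simp only [chebBasis, Polynomial.Sequence.basis_eq_self]
  rfl

/-- The polynomial `∑ₖ sₖ Tₖ` with the coefficient vector `s` in the Chebyshev basis. -/
def chebPoly {U : ℕ} (s : Fin U → ℝ) : ℝ[X] :=
  ∑ k, s k • Polynomial.Chebyshev.T ℝ ((k : ℕ) : ℤ)

/-- `σ` is a sum of squares of polynomials of degree less than `n`. -/
def IsSOS (n : ℕ) (σ : ℝ[X]) : Prop :=
  ∃ (k : ℕ) (r : Fin k → ℝ[X]), (∀ j, r j ∈ degreeLT ℝ n) ∧ σ = ∑ j, r j ^ 2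

/-- The dual `{y | ∀ x ∈ K, xᵀ y ≥ 0}` of a set `K` in `ℝ^U`. -/
def dualCone {U : ℕ} (K : Set (Fin U → ℝ)) : Set (Fin U → ℝ) :=
  {y | ∀ x ∈ K, 0 ≤ x ⬝ᵥ y}

/-- The Hessian matrix of `f` at `x`. -/
def hessian {U : ℕ} (f : (Fin U → ℝ) → ℝ) (x : Fin U → ℝ) : Matrix (Fin U) (Fin U) ℝ :=
  Matrix.of fun j k =>
    fderiv ℝ (fun y => fderiv ℝ f y (Pi.single k 1)) x (Pi.single j 1)

section WSOS

variable {m : ℕ} (w : Fin m → ℝ[X]) (L : Fin m → ℕ) (U : ℕ)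

/-- The Chebyshev coefficient vectors of the weighted sums of squares `∑ᵢ wᵢ σᵢ`, where `σᵢ` is a
sum of squares of polynomials of degree less than `Lᵢ`. -/
def wsosCone : Set (Fin U → ℝ) :=
  {s | ∃ σ : Fin m → ℝ[X], (∀ i, IsSOS (L i) (σ i)) ∧ chebPoly s = ∑ i, w i * σ i}

variable {L U} (p : ∀ i, Module.Basis (Fin (L i)) ℝ (degreeLT ℝ (L i)))

/-- The linear map `Λᵢ` that sends the vector of basis polynomials `(T₀, …, T_{U-1})` to
`wᵢ pᵢ pᵢᵀ`: its `(j, k)` entry at `x` is obtained by writing `wᵢ pᵢⱼ pᵢₖ` as a linear combination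
of the `Tᵤ` and by replacing each `Tᵤ` with `xᵤ`. -/
def lamBlock (i : Fin m) (x : Fin U → ℝ) : Matrix (Fin (L i)) (Fin (L i)) ℝ :=
  Matrix.of fun j k =>
    ∑ u : Fin U, chebBasis.repr (w i * (p i j : ℝ[X]) * (p i k : ℝ[X])) (u : ℕ) * x u

/-- The block diagonal matrix `Λ(x) = Λ₁(x) ⊕ ⋯ ⊕ Λₘ(x)`. -/
def lam (x : Fin U → ℝ) : Matrix (Σ i, Fin (L i)) (Σ i, Fin (L i)) ℝ :=
  Matrix.blockDiagonal' fun i => lamBlock w p i x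

/-- The barrier function `f(x) = - ln det Λ(x)`. -/
def barrier (x : Fin U → ℝ) : ℝ := -Real.log (lam w p x).det

/-- `x` is a dual certificate of `s`: `s` belongs to the weighted sum-of-squares cone `Σ`, `x` to
the interior of the dual cone `Σ*`, and `H(x)⁻¹ s` to `Σ*`, where `H` is the Hessian of the
barrier function. -/
def IsDualCertificate (s x : Fin U → ℝ) : Prop :=
  s ∈ wsosCone w L U ∧ x ∈ interior (dualCone (wsosCone w L U)) ∧
    Matrix.mulVec (hessian (barrier w p) x)⁻¹ s ∈ dualCone (wsosCone w L U)

end WSOS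

/-- The weights describing `[-1, 1]`: `1, 1 - z²` for polynomials of even degree `N` and
`1 - z, 1 + z` for polynomials of odd degree `N`. -/
def intervalWeights (N : ℕ) : Fin 2 → ℝ[X] :=
  if Even N then ![1, 1 - X ^ 2] else ![1 - X, 1 + X]

/-- The dimensions of the spaces of the polynomials whose squares are multiplied by the weights:
degrees at most `d` and `d - 1` if `N = 2 d`, and degrees at most `d` and `d` if `N = 2 d + 1`. -/
def intervalDims (N : ℕ) : Fin 2 → ℕ :=
  if Even N then ![N / 2 + 1, N / 2] else ![(N + 1) / 2, (N + 1) / 2]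

end DualCert

end

noncomputable section

namespace DualCert

/-! ### Sums of squares with degree bounds. -/

section SumsOfSquares

/-! Put `n = N + 1` and let `ε > 0` be a lower bound for the polynomial `t` on `[-1, 1]`. On the
slice `t ⬝ᵥ x = 1` of `Σ*`, which is compact, `det Λ` has a maximizer; multiplied by `n` it becomes
a point `x` with `-∇f(x) = t` and `x 0 ≤ n / ε` (`exists_trace_inv_mul_eq`). Since `H(x) x =
-∇f(x)`, this `x` is a real dual certificate of `t`.

Certificates survive perturbations that are small in the local metric of the barrier. Write `A =
Λ(y)`, `B = Λ(M x)` and `U = M⁻¹ Λ(H(y)⁻¹ t) - A`. In coordinates where `A = 1`, the equation for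
`H(y)⁻¹ t` bounds the Frobenius norm of `U` by that of `B⁻¹ - 1`, so `U` has norm at most `1` and `A
+ U` is positive semidefinite (`posSemidef_add_of_trace_eq`). For `M = 4 n² t₀`, rounding `M x` to
integers is such a small perturbation (`isDualCertificate_of_abs_sub_le`), and the result has size
at most `4 n³ t₀ / ε + 1`.

It remains to bound `1 / ε`. The minimum of `t` is either its value at `±1`, a positive integer, or
a critical value, hence a root of the resultant of `t - μ` and `t'` in `ℤ[μ]`. Its coefficients sum
to at most `2 ^ O(N τ + N²)` in absolute value, and Cauchy's root bound gives `1 / ε ≤ 2 ^ O(N τ +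
N²)` (`one_le_mul_eval_chebPoly`). For `d = 0` the claimed bound is zero, and the constant
polynomial `1` serves as the certificate vector of every `t`. -/

theorem IsSOS.zero (n : ℕ) : IsSOS n 0 := ⟨0, fun _ => 0, fun j => j.elim0, by simp⟩

theorem IsSOS.add {n : ℕ} {σ τ : ℝ[X]} (hσ : IsSOS n σ) (hτ : IsSOS n τ) : IsSOS n (σ + τ) := by
  obtain ⟨k, r, hr, rfl⟩ := hσ
  obtain ⟨l, q, hq, rfl⟩ := hτ
  refine ⟨k + l, Fin.append r q, fun j => ?_, by simp [Fin.sum_univ_add]⟩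
  refine Fin.addCases (fun i => ?_) (fun i => ?_) j
  · simpa using hr i
  · simpa using hq i

theorem IsSOS.sq {n : ℕ} {r : ℝ[X]} (hr : r ∈ degreeLT ℝ n) : IsSOS n (r ^ 2) :=
  ⟨1, fun _ => r, fun _ => hr, by simp⟩

theorem IsSOS.sq_mul {n k : ℕ} {σ g : ℝ[X]} (hg : g.natDegree ≤ k) (hσ : IsSOS n σ) :
    IsSOS (n + k) (g ^ 2 * σ) := by
  obtain ⟨l, r, hr, rfl⟩ := hσ
  refine ⟨l, fun j => g * r j, fun j => ?_, by simp [Finset.mul_sum, mul_pow]⟩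
  have h := hr j
  rw [mem_degreeLT] at h ⊢
  by_cases hg0 : g = 0
  · simp [hg0]
  by_cases hr0 : r j = 0
  · simp [hr0]
  rw [degree_mul, degree_eq_natDegree hg0, degree_eq_natDegree hr0] at *
  norm_cast at *
  omega

theorem IsSOS.C {n : ℕ} {c : ℝ} (hc : 0 ≤ c) : IsSOS (n + 1) (C c) := by
  have : (Polynomial.C c : ℝ[X]) = (Polynomial.C (√c)) ^ 2 := by
    rw [← C_pow, Real.sq_sqrt hc]
  rw [this]
  refine IsSOS.sq ?_
  rw [mem_degreeLT]
  refine lt_of_le_of_lt degree_C_le ?_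
  exact_mod_cast Nat.succ_pos n

theorem IsSOS.eval_nonneg {n : ℕ} {σ : ℝ[X]} (hσ : IsSOS n σ) (z : ℝ) : 0 ≤ σ.eval z := by
  obtain ⟨l, r, hr, rfl⟩ := hσ
  simp only [eval_finsetSum, eval_pow]
  positivity

end SumsOfSquares

/-! ### Lukács' theorem: nonnegative polynomials on `[-1, 1]` are weighted sums of squares. -/

section Interval

theorem intervalWeights_even (d : ℕ) : intervalWeights (2 * d) = ![1, 1 - X ^ 2] := by
  simp [intervalWeights]

theorem intervalWeights_odd (d : ℕ) : intervalWeights (2 * d + 1) = ![1 - X, 1 + X] := by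
  simp [intervalWeights]

theorem intervalDims_even (d : ℕ) : intervalDims (2 * d) = ![d + 1, d] := by
  simp [intervalDims]

theorem intervalDims_odd (d : ℕ) : intervalDims (2 * d + 1) = ![d + 1, d + 1] := by
  have : (2 * d + 1 + 1) / 2 = d + 1 := by omega
  simp [intervalDims, this]

/-- `s` is a weighted sum of squares with the weights of the interval `[-1, 1]` for degree `N`. -/
def IsIntervalSOS (N : ℕ) (s : ℝ[X]) : Prop :=
  ∃ σ : Fin 2 → ℝ[X], (∀ i, IsSOS (intervalDims N i) (σ i)) ∧ s = ∑ i, intervalWeights N i * σ i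

theorem isIntervalSOS_even {d : ℕ} {s : ℝ[X]} : IsIntervalSOS (2 * d) s ↔
    ∃ σ τ, IsSOS (d + 1) σ ∧ IsSOS d τ ∧ s = σ + (1 - X ^ 2) * τ := by
  simp only [IsIntervalSOS, intervalWeights_even, intervalDims_even, Fin.forall_fin_two,
    Fin.sum_univ_two]
  constructor
  · rintro ⟨σ, ⟨h0, h1⟩, rfl⟩
    exact ⟨σ 0, σ 1, h0, h1, by simp⟩
  · rintro ⟨σ, τ, h0, h1, rfl⟩
    exact ⟨![σ, τ], ⟨h0, h1⟩, by simp⟩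

theorem isIntervalSOS_odd {d : ℕ} {s : ℝ[X]} : IsIntervalSOS (2 * d + 1) s ↔
    ∃ σ τ, IsSOS (d + 1) σ ∧ IsSOS (d + 1) τ ∧ s = (1 - X) * σ + (1 + X) * τ := by
  simp only [IsIntervalSOS, intervalWeights_odd, intervalDims_odd, Fin.forall_fin_two,
    Fin.sum_univ_two]
  constructor
  · rintro ⟨σ, ⟨h0, h1⟩, rfl⟩
    exact ⟨σ 0, σ 1, h0, h1, by simp⟩
  · rintro ⟨σ, τ, h0, h1, rfl⟩
    exact ⟨![σ, τ], ⟨h0, h1⟩, by simp⟩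

theorem IsIntervalSOS.add {N : ℕ} {s t : ℝ[X]} (hs : IsIntervalSOS N s) (ht : IsIntervalSOS N t) :
    IsIntervalSOS N (s + t) := by
  obtain ⟨σ, hσ, rfl⟩ := hs
  obtain ⟨τ, hτ, rfl⟩ := ht
  exact ⟨σ + τ, fun i => (hσ i).add (hτ i), by simp [mul_add, Finset.sum_add_distrib]⟩

theorem IsIntervalSOS.C (N : ℕ) {c : ℝ} (hc : 0 ≤ c) : IsIntervalSOS N (C c) := by
  obtain ⟨d, rfl | rfl⟩ := Nat.even_or_odd' N
  · exact isIntervalSOS_even.2 ⟨_, 0, IsSOS.C hc, IsSOS.zero _, by simp⟩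
  · refine isIntervalSOS_odd.2 ⟨Polynomial.C (c / 2), Polynomial.C (c / 2),
      IsSOS.C (by positivity), IsSOS.C (by positivity), ?_⟩
    have : (Polynomial.C c : ℝ[X]) = Polynomial.C (c / 2) + Polynomial.C (c / 2) := by
      rw [← C_add]; ring_nf
    rw [this]; ring

theorem IsIntervalSOS.sq_mul {N : ℕ} {s g : ℝ[X]} (hg : g.natDegree ≤ 1)
    (hs : IsIntervalSOS N s) : IsIntervalSOS (N + 2) (g ^ 2 * s) := by
  obtain ⟨d, rfl | rfl⟩ := Nat.even_or_odd' N
  · obtain ⟨σ, τ, h0, h1, rfl⟩ := isIntervalSOS_even.1 hs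
    exact (isIntervalSOS_even (d := d + 1)).2
      ⟨g ^ 2 * σ, g ^ 2 * τ, h0.sq_mul hg, h1.sq_mul hg, by ring⟩
  · obtain ⟨σ, τ, h0, h1, rfl⟩ := isIntervalSOS_odd.1 hs
    exact (isIntervalSOS_odd (d := d + 1)).2
      ⟨g ^ 2 * σ, g ^ 2 * τ, h0.sq_mul hg, h1.sq_mul hg, by ring⟩

theorem natDegree_one_sub_X_le : (1 - X : ℝ[X]).natDegree ≤ 1 := by compute_degree

theorem natDegree_one_add_X_le : (1 + X : ℝ[X]).natDegree ≤ 1 := by compute_degree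

/-- Multiplication by an endpoint factor exchanges the two parities: `(1 - z)(1 - z²) = (1 + z)(1 -
z)²` and `(1 - z)(1 + z) = 1 - z²`, so every weight turns into a weight of the other parity times a
square. -/
theorem IsIntervalSOS.one_sub_X_mul {N : ℕ} {s : ℝ[X]} (hs : IsIntervalSOS N s) :
    IsIntervalSOS (N + 1) ((1 - X) * s) := by
  obtain ⟨d, rfl | rfl⟩ := Nat.even_or_odd' N
  · obtain ⟨σ, τ, h0, h1, rfl⟩ := isIntervalSOS_even.1 hs
    exact isIntervalSOS_odd.2
      ⟨σ, (1 - X) ^ 2 * τ, h0, h1.sq_mul natDegree_one_sub_X_le, by ring⟩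
  · obtain ⟨σ, τ, h0, h1, rfl⟩ := isIntervalSOS_odd.1 hs
    exact (isIntervalSOS_even (d := d + 1)).2
      ⟨(1 - X) ^ 2 * σ, τ, h0.sq_mul natDegree_one_sub_X_le, h1, by ring⟩

theorem IsIntervalSOS.one_add_X_mul {N : ℕ} {s : ℝ[X]} (hs : IsIntervalSOS N s) :
    IsIntervalSOS (N + 1) ((1 + X) * s) := by
  obtain ⟨d, rfl | rfl⟩ := Nat.even_or_odd' N
  · obtain ⟨σ, τ, h0, h1, rfl⟩ := isIntervalSOS_even.1 hs
    exact isIntervalSOS_odd.2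
      ⟨(1 + X) ^ 2 * τ, σ, h1.sq_mul natDegree_one_add_X_le, h0, by ring⟩
  · obtain ⟨σ, τ, h0, h1, rfl⟩ := isIntervalSOS_odd.1 hs
    exact (isIntervalSOS_even (d := d + 1)).2
      ⟨(1 + X) ^ 2 * τ, σ, h1.sq_mul natDegree_one_add_X_le, h0, by ring⟩

theorem IsIntervalSOS.eval_nonneg {N : ℕ} {s : ℝ[X]} (hs : IsIntervalSOS N s) {z : ℝ}
    (hz : z ∈ Set.Icc (-1 : ℝ) 1) : 0 ≤ s.eval z := by
  obtain ⟨h1, h2⟩ := hz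
  obtain ⟨d, rfl | rfl⟩ := Nat.even_or_odd' N
  · obtain ⟨σ, τ, h0, h1, rfl⟩ := isIntervalSOS_even.1 hs
    have := h0.eval_nonneg z
    have := mul_nonneg (show 0 ≤ 1 - z ^ 2 by nlinarith) (h1.eval_nonneg z)
    simp; linarith
  · obtain ⟨σ, τ, h0, h1, rfl⟩ := isIntervalSOS_odd.1 hs
    have := mul_nonneg (show 0 ≤ 1 - z by linarith) (h0.eval_nonneg z)
    have := mul_nonneg (show 0 ≤ 1 + z by linarith) (h1.eval_nonneg z)
    simp; linarith

/-- Dividing a nonnegative polynomial by a factor vanishing at `a` loses the sign at `a` itself;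
continuity along a segment inside the interval restores it, also at the endpoints. -/
theorem eval_nonneg_of_forall_ne {q : ℝ[X]} {a : ℝ}
    (h : ∀ z ∈ Set.Icc (-1 : ℝ) 1, z ≠ a → 0 ≤ q.eval z) :
    ∀ z ∈ Set.Icc (-1 : ℝ) 1, 0 ≤ q.eval z := by
  intro z hz
  rcases ne_or_eq z a with hza | rfl
  · exact h z hz hza
  obtain ⟨c, hc, hcz⟩ : ∃ c ∈ Set.Icc (-1 : ℝ) 1, c ≠ z := by
    rcases eq_or_ne z 0 with rfl | h0
    · exact ⟨1, by norm_num, by norm_num⟩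
    · exact ⟨0, by norm_num, h0.symm⟩
  have hlim : Filter.Tendsto (fun r : ℝ => q.eval (z + r * (c - z))) (nhdsWithin 0 (Set.Ioi 0))
      (nhds (q.eval z)) := by
    have : Continuous fun r : ℝ => q.eval (z + r * (c - z)) := by fun_prop
    simpa using (this.tendsto 0).mono_left nhdsWithin_le_nhds
  refine ge_of_tendsto hlim ?_
  filter_upwards [Ioo_mem_nhdsGT (zero_lt_one : (0 : ℝ) < 1)] with r hr
  refine h _ ?_ ?_
  · have := (convex_Icc (-1 : ℝ) 1).add_smul_sub_mem hz hc ⟨hr.1.le, hr.2.le⟩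
    simpa using this
  · simpa [sub_eq_zero, hcz] using hr.1.ne'

/-- The Lukács theorem: a polynomial of degree at most `N` that is nonnegative on `[-1, 1]` is a
weighted sum of squares. -/
theorem isIntervalSOS_of_nonneg (N : ℕ) (s : ℝ[X]) (hN : s.natDegree ≤ N)
    (hs : ∀ z ∈ Set.Icc (-1 : ℝ) 1, 0 ≤ s.eval z) : IsIntervalSOS N s := by
  induction N using Nat.strong_induction_on generalizing s with
  | _ N ih =>
  -- Subtracting the minimum, a nonnegative constant, creates a root at the minimizer `a`. An
  -- endpoint root splits off `1 - X` or `1 + X`; an interior one is a critical point, hence a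
  -- double root, and splits off a square. The quotient is again nonnegative and has smaller degree.
  obtain ⟨a, ha, hmin⟩ := isCompact_Icc.exists_isMinOn
    (Set.nonempty_Icc.2 (by norm_num : (-1 : ℝ) ≤ 1)) s.continuous.continuousOn
  have hmin : ∀ z ∈ Set.Icc (-1 : ℝ) 1, s.eval a ≤ s.eval z := fun z hz => hmin hz
  obtain ⟨q, hq⟩ : X - C a ∣ s - C (s.eval a) := dvd_iff_isRoot.2 (by simp)
  have hsq : s = C (s.eval a) + (X - C a) * q := by rw [← hq]; ring
  have hC := IsIntervalSOS.C N (hs a ha)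
  by_cases hq0 : q = 0
  · rw [hsq, hq0]; simpa using hC
  have hdeg : q.natDegree + 1 ≤ N := by
    have h1 : (s - C (s.eval a)).natDegree ≤ N := by simpa using hN
    rw [hq, natDegree_mul (X_sub_C_ne_zero a) hq0, natDegree_X_sub_C] at h1
    omega
  obtain ⟨M, rfl⟩ : ∃ M, N = M + 1 := ⟨N - 1, by omega⟩
  have hev : ∀ z ∈ Set.Icc (-1 : ℝ) 1, 0 ≤ (z - a) * q.eval z := fun z hz => by
    have h1 := hmin z hz
    rw [hsq] at h1
    simpa using h1
  rcases eq_or_ne a 1 with rfl | ha1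
  · have : IsIntervalSOS M (-q) := by
      refine ih M (by omega) _ (by rw [natDegree_neg]; omega) (eval_nonneg_of_forall_ne (a := 1) ?_)
      intro z hz hza
      have hlt : z < 1 := lt_of_le_of_ne hz.2 hza
      rw [eval_neg]
      nlinarith [hev z hz]
    rw [hsq]
    convert hC.add this.one_sub_X_mul using 2
    simp; ring
  rcases eq_or_ne a (-1) with rfl | ha2
  · have : IsIntervalSOS M q := by
      refine ih M (by omega) _ (by omega) (eval_nonneg_of_forall_ne (a := -1) ?_)
      intro z hz hza
      have hlt : -1 < z := lt_of_le_of_ne hz.1 (Ne.symm hza)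
      nlinarith [hev z hz]
    rw [hsq]
    convert hC.add this.one_add_X_mul using 2
    rw [C_neg, C_1]; ring
  have hlt1 : a < 1 := lt_of_le_of_ne ha.2 ha1
  have hlt2 : -1 < a := lt_of_le_of_ne ha.1 (Ne.symm ha2)
  have hder : (derivative s).eval a = 0 := by
    have hloc : IsLocalMin (fun z => s.eval z) a := by
      filter_upwards [Icc_mem_nhds hlt2 hlt1] with z hz using hmin z hz
    exact hloc.hasDerivAt_eq_zero (s.hasDerivAt a)
  have hqa : q.eval a = 0 := by
    rw [hsq] at hder
    simpa using hder
  obtain ⟨r, hr⟩ : X - C a ∣ q := dvd_iff_isRoot.2 hqa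
  have hr0 : r ≠ 0 := by rintro rfl; simp at hr; exact hq0 hr
  rw [hr, natDegree_mul (X_sub_C_ne_zero a) hr0, natDegree_X_sub_C] at hdeg
  obtain ⟨K, rfl⟩ : ∃ K, M = K + 1 := ⟨M - 1, by omega⟩
  have : IsIntervalSOS K r := by
    refine ih K (by omega) _ (by omega) (eval_nonneg_of_forall_ne (a := a) ?_)
    intro z hz hza
    have h1 := hev z hz
    rw [hr, eval_mul, eval_sub, eval_X, eval_C, ← mul_assoc] at h1
    have : 0 < (z - a) * (z - a) := mul_self_pos.2 (sub_ne_zero.2 hza)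
    exact nonneg_of_mul_nonneg_right h1 this
  rw [hsq, hr, ← mul_assoc, ← pow_two]
  exact hC.add (this.sq_mul (natDegree_X_sub_C_le a))

end Interval

/-! ### The coefficient sum of integer polynomials and Cauchy's root bound. -/

section CoeffSum

/-- The sum of the absolute values of the coefficients of an integer polynomial. -/
def coeffSum (p : ℤ[X]) : ℤ := p.sum fun _ a => |a|

theorem coeffSum_eq_of_lt {p : ℤ[X]} {n : ℕ} (h : p.natDegree < n) :
    coeffSum p = ∑ i ∈ Finset.range n, |p.coeff i| :=
  p.sum_over_range' (fun _ => abs_zero) n h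

theorem coeffSum_nonneg (p : ℤ[X]) : 0 ≤ coeffSum p :=
  Finset.sum_nonneg fun _ _ => abs_nonneg _

@[simp] theorem coeffSum_zero : coeffSum 0 = 0 := by simp [coeffSum]

@[simp] theorem coeffSum_C (a : ℤ) : coeffSum (C a) = |a| := sum_C_index abs_zero

theorem coeffSum_neg (p : ℤ[X]) : coeffSum (-p) = coeffSum p := by
  rw [coeffSum_eq_of_lt (Nat.lt_succ_self _), coeffSum_eq_of_lt (Nat.lt_succ_self _)]
  simp

theorem coeffSum_add_le (p q : ℤ[X]) : coeffSum (p + q) ≤ coeffSum p + coeffSum q := by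
  set n := max p.natDegree q.natDegree + 1
  rw [coeffSum_eq_of_lt (n := n) (by have := natDegree_add_le p q; omega),
    coeffSum_eq_of_lt (p := p) (n := n) (by omega), coeffSum_eq_of_lt (p := q) (n := n) (by omega),
    ← Finset.sum_add_distrib]
  exact Finset.sum_le_sum fun i _ => by rw [coeff_add]; exact abs_add_le _ _

theorem coeffSum_sum_le {ι : Type*} (s : Finset ι) (p : ι → ℤ[X]) :
    coeffSum (∑ i ∈ s, p i) ≤ ∑ i ∈ s, coeffSum (p i) :=
  Finset.le_sum_of_subadditive _ coeffSum_zero.le coeffSum_add_le s p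

theorem coeffSum_C_mul (a : ℤ) (p : ℤ[X]) : coeffSum (C a * p) = |a| * coeffSum p := by
  have h : (C a * p).natDegree < p.natDegree + 1 := Nat.lt_succ_of_le (natDegree_C_mul_le a p)
  rw [coeffSum_eq_of_lt h, coeffSum_eq_of_lt (Nat.lt_succ_self _), Finset.mul_sum]
  simp [abs_mul]

theorem coeffSum_X_mul (p : ℤ[X]) : coeffSum (X * p) = coeffSum p := by
  have h : (X * p).natDegree < p.natDegree + 1 + 1 := by
    have := natDegree_mul_le (p := (X : ℤ[X])) (q := p)
    rw [natDegree_X] at this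
    omega
  rw [coeffSum_eq_of_lt h, coeffSum_eq_of_lt (Nat.lt_succ_self _), Finset.sum_range_succ']
  simp

theorem coeffSum_X_pow_mul (n : ℕ) (p : ℤ[X]) : coeffSum (X ^ n * p) = coeffSum p := by
  induction n with
  | zero => simp
  | succ n ih => rw [pow_succ', mul_assoc, coeffSum_X_mul, ih]

theorem coeffSum_mul_le (p q : ℤ[X]) : coeffSum (p * q) ≤ coeffSum p * coeffSum q := by
  conv_lhs => rw [p.as_sum_range' _ (Nat.lt_succ_self _), Finset.sum_mul]
  refine (coeffSum_sum_le _ _).trans (le_of_eq ?_)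
  rw [coeffSum_eq_of_lt (p := p) (Nat.lt_succ_self _), Finset.sum_mul]
  refine Finset.sum_congr rfl fun i _ => ?_
  rw [← C_mul_X_pow_eq_monomial, mul_assoc, coeffSum_C_mul, coeffSum_X_pow_mul]

theorem coeffSum_prod_le {ι : Type*} (s : Finset ι) (p : ι → ℤ[X]) :
    coeffSum (∏ i ∈ s, p i) ≤ ∏ i ∈ s, coeffSum (p i) := by
  classical
  induction s using Finset.induction_on with
  | empty => rw [Finset.prod_empty, Finset.prod_empty, ← C_1, coeffSum_C, abs_one]
  | insert a s ha ih =>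
    rw [Finset.prod_insert ha, Finset.prod_insert ha]
    exact (coeffSum_mul_le _ _).trans (mul_le_mul_of_nonneg_left ih (coeffSum_nonneg _))

/-- Leibniz expansion: `n!` signed products of `n` entries, with `coeffSum` subadditive and
submultiplicative. -/
theorem coeffSum_det_le {n : ℕ} (M : Matrix (Fin n) (Fin n) ℤ[X]) {B : ℤ}
    (hM : ∀ i j, coeffSum (M i j) ≤ B) : coeffSum M.det ≤ n.factorial * B ^ n := by
  rw [Matrix.det_apply]
  refine (coeffSum_sum_le _ _).trans ?_
  have hterm : ∀ σ ∈ (Finset.univ : Finset (Equiv.Perm (Fin n))),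
      coeffSum (Equiv.Perm.sign σ • ∏ i, M (σ i) i) ≤ B ^ n := by
    intro σ _
    have h1 : coeffSum (Equiv.Perm.sign σ • ∏ i, M (σ i) i) = coeffSum (∏ i, M (σ i) i) := by
      rcases Int.units_eq_one_or (Equiv.Perm.sign σ) with h | h <;> simp [h, coeffSum_neg]
    rw [h1]
    refine (coeffSum_prod_le _ _).trans ?_
    refine (Finset.prod_le_prod (fun _ _ => coeffSum_nonneg _) fun i _ => hM (σ i) i).trans ?_
    simp
  refine (Finset.sum_le_sum hterm).trans ?_
  simp [Fintype.card_perm]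

theorem abs_aeval_le_coeffSum (p : ℤ[X]) {x : ℝ} (h0 : 0 ≤ x) (h1 : x ≤ 1) :
    |aeval x p| ≤ coeffSum p := by
  rw [aeval_eq_sum_range, coeffSum_eq_of_lt (Nat.lt_succ_self _)]
  push_cast
  refine (Finset.abs_sum_le_sum_abs _ _).trans (Finset.sum_le_sum fun i _ => ?_)
  rw [zsmul_eq_mul, abs_mul, abs_pow, abs_of_nonneg h0]
  exact mul_le_of_le_one_right (abs_nonneg _) (pow_le_one₀ h0 h1)

/-- Cauchy's lower bound for the positive roots of an integer polynomial. -/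
theorem one_le_coeffSum_mul_of_aeval_eq_zero {p : ℤ[X]} (hp : p ≠ 0) {x : ℝ} (h0 : 0 < x)
    (h1 : x ≤ 1) (hx : aeval x p = 0) : 1 ≤ coeffSum p * x := by
  -- Removing the powers of `X` leaves `q` with a nonzero integer constant term. At the root `x`
  -- this term equals `-x` times the value of `q.divX`, which is at most `coeffSum q`.
  obtain ⟨q, hq, hdvd⟩ := exists_eq_pow_rootMultiplicity_mul_and_not_dvd p hp 0
  rw [C_0, sub_zero] at hq hdvd
  rw [X_dvd_iff] at hdvd
  rw [hq, coeffSum_X_pow_mul]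
  have hqx : aeval x q = 0 := by
    rw [hq] at hx
    simpa [h0.ne'] using hx
  have hdiv : coeffSum q.divX ≤ coeffSum q := by
    have h2 : coeffSum q = ∑ i ∈ Finset.range (q.natDegree + 1 + 1), |q.coeff i| :=
      coeffSum_eq_of_lt (by omega)
    rw [h2, Finset.sum_range_succ', coeffSum_eq_of_lt (p := q.divX) (n := q.natDegree + 1)
      (by rw [natDegree_divX_eq_natDegree_tsub_one]; omega)]
    simp
  have hsum : x * aeval x q.divX + q.coeff 0 = 0 := by
    have h3 := congrArg (aeval x) q.X_mul_divX_add
    simpa [hqx] using h3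
  have h4 : (1 : ℝ) ≤ |(q.coeff 0 : ℝ)| := by exact_mod_cast Int.one_le_abs hdvd
  have h5 : |(q.coeff 0 : ℝ)| = |aeval x q.divX| * x := by
    rw [show (q.coeff 0 : ℝ) = -(x * aeval x q.divX) by linarith, abs_neg, abs_mul,
      abs_of_pos h0, mul_comm]
  have h6 : |aeval x q.divX| ≤ coeffSum q :=
    (abs_aeval_le_coeffSum _ h0.le h1).trans (by exact_mod_cast hdiv)
  rw [h5] at h4
  exact h4.trans (mul_le_mul_of_nonneg_right h6 h0.le)

end CoeffSum

/-! ### Positive critical values of integer polynomials. -/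

section CriticalValues

/-- The resultant of `f - μ` and `f'` as a polynomial in `μ`, whose roots are the critical values
of `f`. -/
def criticalPoly (f : ℤ[X]) : ℤ[X] :=
  resultant (f.map C - C X) (f.derivative.map C) f.natDegree f.derivative.natDegree

/-- Subtracting a constant does not change `natDegree`, so the fixed degrees in the definition agree
with the actual ones for every `μ` and the resultant commutes with specialization. -/
theorem aeval_criticalPoly {K : Type*} [Field K] [CharZero K] (f : ℤ[X]) (μ : K) :
    aeval μ (criticalPoly f) =
      resultant (f.map (algebraMap ℤ K) - C μ) (f.map (algebraMap ℤ K)).derivative := by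
  have hinj : Function.Injective (algebraMap ℤ K) := (algebraMap ℤ K).injective_int
  have hcomp : ((aeval μ : ℤ[X] →ₐ[ℤ] K) : ℤ[X] →+* K).comp C = algebraMap ℤ K := by
    ext
    simp
  rw [natDegree_sub_C, derivative_map, natDegree_map_eq_of_injective hinj,
    natDegree_map_eq_of_injective hinj, criticalPoly]
  have := resultant_map_map (f.map C - C X) (f.derivative.map C) f.natDegree
    f.derivative.natDegree ((aeval μ : ℤ[X] →ₐ[ℤ] K) : ℤ[X] →+* K)
  rw [Polynomial.map_sub, Polynomial.map_map, Polynomial.map_map, hcomp, Polynomial.map_C,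
    RingHom.coe_coe, aeval_X] at this
  exact this.symm

/-- There are finitely many complex critical values. For any other `μ`, `f - μ` and `f'` have no
common root, so the resultant is nonzero at `μ`. -/
theorem criticalPoly_ne_zero {f : ℤ[X]} (hf : f.derivative ≠ 0) : criticalPoly f ≠ 0 := by
  intro h0
  have hinj : Function.Injective (algebraMap ℤ ℂ) := (algebraMap ℤ ℂ).injective_int
  set g := f.map (algebraMap ℤ ℂ) with hg
  have hg' : g.derivative ≠ 0 := by
    rw [hg, derivative_map]
    exact (Polynomial.map_ne_zero_iff hinj).2 hf
  obtain ⟨μ, hμ⟩ := ((g.derivative.roots.toFinset.image fun z => g.eval z)).exists_notMem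
  have h1 := aeval_criticalPoly f μ
  rw [h0, map_zero, eq_comm, resultant_eq_zero_iff] at h1
  refine h1.2 ?_
  rw [isCoprime_iff_aeval_ne_zero_of_isAlgClosed ℂ ℂ]
  intro z
  by_contra! h2
  refine hμ (Finset.mem_image.2 ⟨z, ?_, ?_⟩)
  · rw [Multiset.mem_toFinset, mem_roots hg', IsRoot.def]
    exact h2.2
  · have h3 : eval z (g - C μ) = 0 := h2.1
    simpa [sub_eq_zero] using h3

/-- The Sylvester matrix has order at most `2 * N`. Its only entries involving the variable are
`f.coeff 0 - X`, which is why the coefficients of `f` need the extra `1` in the bound. -/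
theorem coeffSum_criticalPoly_le {f : ℤ[X]} {N : ℕ} {B : ℤ} (hN : f.natDegree ≤ N)
    (hB : ∀ i, |f.coeff i| + 1 ≤ B) (hB' : ∀ i, |f.derivative.coeff i| ≤ B) :
    coeffSum (criticalPoly f) ≤ (2 * N).factorial * B ^ (2 * N) := by
  have hB1 : 1 ≤ B := by have := hB 0; have := abs_nonneg (f.coeff 0); omega
  have hdeg : f.natDegree + f.derivative.natDegree ≤ 2 * N := by
    have := natDegree_derivative_le f; omega
  refine (coeffSum_det_le _ (B := B) fun i j => ?_).trans ?_
  · induction j using Fin.addCases with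
    | left j =>
      simp only [sylvester, Matrix.of_apply, Fin.addCases_left]
      split_ifs
      · rw [coeff_map, coeffSum_C]
        exact hB' _
      · simp; omega
    | right j =>
      simp only [sylvester, Matrix.of_apply, Fin.addCases_right]
      split_ifs
      · rw [coeff_sub, coeff_map, coeff_C]
        split_ifs
        · rw [sub_eq_add_neg]
          refine (coeffSum_add_le _ _).trans ?_
          rw [coeffSum_neg, coeffSum_C, show coeffSum X = 1 by simp [coeffSum]]
          exact hB _
        · rw [sub_zero, coeffSum_C]
          linarith [hB ((i : ℕ) - j)]
      · simp; omega
  · gcongr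

/-- A positive critical value of an integer polynomial is bounded away from zero. -/
theorem one_le_mul_aeval_of_aeval_derivative_eq_zero {f : ℤ[X]} {N : ℕ} {B : ℤ}
    (hN : f.natDegree ≤ N) (hB : ∀ i, |f.coeff i| + 1 ≤ B)
    (hB' : ∀ i, |f.derivative.coeff i| ≤ B) {z : ℝ} (hz : aeval z f.derivative = 0)
    (hpos : 0 < aeval z f) : 1 ≤ (2 * N).factorial * (B : ℝ) ^ (2 * N) * aeval z f := by
  have hB1 : 1 ≤ B := by have := hB 0; have := abs_nonneg (f.coeff 0); omega
  have hB1' : (1 : ℝ) ≤ B := by exact_mod_cast hB1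
  have hfac : (1 : ℝ) ≤ (2 * N).factorial := by
    exact_mod_cast Nat.one_le_iff_ne_zero.2 (Nat.factorial_ne_zero _)
  have hK : (1 : ℝ) ≤ (2 * N).factorial * (B : ℝ) ^ (2 * N) :=
    one_le_mul_of_one_le_of_one_le hfac (one_le_pow₀ hB1')
  rcases le_or_gt 1 (aeval z f) with h1 | h1
  · exact one_le_mul_of_one_le_of_one_le hK h1
  -- A constant `f` would be an integer strictly between `0` and `1`.
  by_cases hf : f.derivative = 0
  · exfalso
    obtain ⟨a, rfl⟩ : ∃ a, f = C a := 
      ⟨_, eq_C_of_natDegree_eq_zero (derivative_eq_zero.1 hf)⟩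
    rw [aeval_C] at h1 hpos
    simp only [algebraMap_int_eq, eq_intCast] at h1 hpos
    norm_cast at h1 hpos
    omega
  have hroot : aeval (aeval z f) (criticalPoly f) = 0 := by
    rw [aeval_criticalPoly, resultant_eq_zero_iff]
    have hinj : Function.Injective (algebraMap ℤ ℝ) := (algebraMap ℤ ℝ).injective_int
    refine ⟨Or.inr ?_, ?_⟩
    · rw [derivative_map]
      exact (Polynomial.map_ne_zero_iff hinj).2 hf
    · rintro ⟨a, b, hab⟩
      have h2 := congrArg (eval z) hab
      rw [eval_add, eval_mul, eval_mul, eval_sub, eval_C, derivative_map, eval_map_algebraMap,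
        eval_map_algebraMap, hz] at h2
      simp at h2
  refine (one_le_coeffSum_mul_of_aeval_eq_zero (criticalPoly_ne_zero hf) hpos h1.le hroot).trans ?_
  gcongr
  exact_mod_cast coeffSum_criticalPoly_le hN hB hB'

end CriticalValues

/-! ### Lower bound for the minimum of a positive polynomial with integer Chebyshev coefficients. -/

section IntegerChebyshev

/-- The integer polynomial with Chebyshev coefficients `t`. -/
def intChebPoly {U : ℕ} (t : Fin U → ℤ) : ℤ[X] := ∑ k, C (t k) * Chebyshev.T ℤ ((k : ℕ) : ℤ)

theorem map_intChebPoly {U : ℕ} (t : Fin U → ℤ) :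
    (intChebPoly t).map (algebraMap ℤ ℝ) = chebPoly fun k => (t k : ℝ) := by
  simp [intChebPoly, chebPoly, Polynomial.map_sum, smul_eq_C_mul, Chebyshev.map_T]

theorem coeffSum_T_le (k : ℕ) : coeffSum (Chebyshev.T ℤ k) ≤ 3 ^ k := by
  induction k using Nat.strong_induction_on with
  | _ k ih =>
  rcases k with - | - | k
  · rw [Nat.cast_zero, Chebyshev.T_zero, ← C_1, coeffSum_C]
    simp
  · rw [show Chebyshev.T ℤ ((0 + 1 : ℕ) : ℤ) = X by simp]
    simp [coeffSum]
  · have h1 := ih (k + 1) (by omega)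
    have h0 := ih k (by omega)
    have hrec : Chebyshev.T ℤ ((k + 1 + 1 : ℕ) : ℤ) =
        C 2 * (X * Chebyshev.T ℤ ((k + 1 : ℕ) : ℤ)) + -Chebyshev.T ℤ (k : ℤ) := by
      have := Chebyshev.T_add_two ℤ k
      push_cast
      rw [show (k : ℤ) + 1 + 1 = k + 2 by ring, this, show (C 2 : ℤ[X]) = 2 from rfl]
      ring
    rw [hrec]
    refine (coeffSum_add_le _ _).trans ?_
    rw [coeffSum_neg, coeffSum_C_mul, coeffSum_X_mul]
    have h3 : (0 : ℤ) ≤ 3 ^ k := by positivity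
    rw [pow_succ] at h1 ⊢
    rw [pow_succ]
    push_cast at h1 ⊢
    norm_num
    linarith

theorem coeffSum_intChebPoly_le {N : ℕ} {t : Fin (N + 1) → ℤ} {b : ℤ} (ht : ∀ k, |t k| ≤ b) :
    coeffSum (intChebPoly t) ≤ (N + 1) * (b * 3 ^ N) := by
  have hb : 0 ≤ b := (abs_nonneg _).trans (ht 0)
  refine (coeffSum_sum_le _ _).trans ?_
  refine (Finset.sum_le_card_nsmul _ _ (b * 3 ^ N) fun k _ => ?_).trans (by simp)
  rw [coeffSum_C_mul]
  refine mul_le_mul (ht k) ((coeffSum_T_le k).trans ?_) (coeffSum_nonneg _) hb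
  exact pow_le_pow_right₀ (by norm_num) (by omega)

theorem natDegree_chebPoly_le {N : ℕ} (t : Fin (N + 1) → ℝ) : (chebPoly t).natDegree ≤ N := by
  refine natDegree_sum_le_of_forall_le _ _ fun k _ => ?_
  refine (natDegree_smul_le _ _).trans ?_
  rw [Chebyshev.natDegree_T]
  simp; omega

theorem abs_coeff_le_coeffSum (p : ℤ[X]) (i : ℕ) : |p.coeff i| ≤ coeffSum p := by
  rw [coeffSum_eq_of_lt (n := max p.natDegree i + 1) (by omega)]
  exact Finset.single_le_sum (f := fun i => |p.coeff i|) (fun _ _ => abs_nonneg _)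
    (Finset.mem_range.2 (by omega))

/-- The bound for the coefficients of the polynomials with Chebyshev coefficients at most `b` and
of their derivatives. -/
def chebCoeffBound (N : ℕ) (b : ℤ) : ℤ := (N + 2) * ((N + 1) * (b * 3 ^ N))

theorem one_le_mul_eval_chebPoly {N : ℕ} {t : Fin (N + 1) → ℤ} {b : ℤ} (ht : ∀ k, |t k| ≤ b)
    (hb : 1 ≤ b) (hpos : ∀ z ∈ Set.Icc (-1 : ℝ) 1, 0 < (chebPoly fun k => (t k : ℝ)).eval z)
    {z : ℝ} (hz : z ∈ Set.Icc (-1 : ℝ) 1) :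
    1 ≤ (2 * N).factorial * (chebCoeffBound N b : ℝ) ^ (2 * N) *
      (chebPoly fun k => (t k : ℝ)).eval z := by
  set f := intChebPoly t with hf
  have hinj : Function.Injective (algebraMap ℤ ℝ) := (algebraMap ℤ ℝ).injective_int
  have hmap := map_intChebPoly t
  have hdeg : f.natDegree ≤ N := by
    rw [← natDegree_map_eq_of_injective hinj, hmap]
    exact natDegree_chebPoly_le _
  have heval : ∀ x : ℝ, aeval x f = (chebPoly fun k => (t k : ℝ)).eval x := fun x => by
    rw [← hmap, eval_map_algebraMap]
  have hsum := coeffSum_intChebPoly_le ht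
  have h3 : (1 : ℤ) ≤ 3 ^ N := one_le_pow₀ (by norm_num)
  have hS1 : 1 ≤ (N + 1 : ℤ) * (b * 3 ^ N) :=
    one_le_mul_of_one_le_of_one_le (by omega) (one_le_mul_of_one_le_of_one_le hb h3)
  have hB : ∀ i, |f.coeff i| + 1 ≤ chebCoeffBound N b := fun i => by
    have := abs_coeff_le_coeffSum f i
    unfold chebCoeffBound
    nlinarith
  have hB' : ∀ i, |f.derivative.coeff i| ≤ chebCoeffBound N b := fun i => by
    rw [coeff_derivative, abs_mul]
    have h1 := abs_coeff_le_coeffSum f (i + 1)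
    rcases le_or_gt (i + 1) N with hi | hi
    · have h2 : |(i : ℤ) + 1| ≤ N := by rw [abs_of_nonneg (by positivity)]; exact_mod_cast hi
      have h4 : |f.coeff (i + 1)| * |(i : ℤ) + 1| ≤ ((N + 1) * (b * 3 ^ N)) * N :=
        mul_le_mul (h1.trans hsum) h2 (abs_nonneg _) (by linarith)
      unfold chebCoeffBound
      nlinarith
    · rw [coeff_eq_zero_of_natDegree_lt (by omega)]
      simp only [abs_zero, zero_mul]
      unfold chebCoeffBound
      positivity
  have hB1 : 1 ≤ chebCoeffBound N b := by
    have := hB 0; have := abs_nonneg (f.coeff 0); omega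
  have hB1' : (1 : ℝ) ≤ chebCoeffBound N b := by exact_mod_cast hB1
  have hfac : (1 : ℝ) ≤ (2 * N).factorial := by
    exact_mod_cast Nat.one_le_iff_ne_zero.2 (Nat.factorial_ne_zero _)
  have hK : (1 : ℝ) ≤ (2 * N).factorial * (chebCoeffBound N b : ℝ) ^ (2 * N) :=
    one_le_mul_of_one_le_of_one_le hfac (one_le_pow₀ hB1')
  have hint : ∀ n : ℤ, 0 < aeval (n : ℝ) f → 1 ≤ aeval (n : ℝ) f := fun n hn => by
    have h : aeval (n : ℝ) f = ((f.eval n : ℤ) : ℝ) :=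
      aeval_algebraMap_apply_eq_algebraMap_eval n f
    rw [h] at hn ⊢
    exact_mod_cast hn
  obtain ⟨a, ha, hmin⟩ := isCompact_Icc.exists_isMinOn
    (Set.nonempty_Icc.2 (by norm_num : (-1 : ℝ) ≤ 1))
    (chebPoly fun k => (t k : ℝ)).continuous.continuousOn
  have hposa := hpos a ha
  rw [← heval] at hposa
  -- The minimum is attained at `±1`, where the value is a positive integer, or at an interior
  -- critical point.
  have hkey : 1 ≤ (2 * N).factorial * (chebCoeffBound N b : ℝ) ^ (2 * N) * aeval a f := by
    rcases eq_or_ne a 1 with rfl | ha1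
    · exact one_le_mul_of_one_le_of_one_le hK (by simpa using hint 1 (by simpa using hposa))
    rcases eq_or_ne a (-1) with rfl | ha2
    · exact one_le_mul_of_one_le_of_one_le hK (by simpa using hint (-1) (by simpa using hposa))
    refine one_le_mul_aeval_of_aeval_derivative_eq_zero hdeg hB hB' ?_ hposa
    have hlt1 : a < 1 := lt_of_le_of_ne ha.2 ha1
    have hlt2 : -1 < a := lt_of_le_of_ne ha.1 (Ne.symm ha2)
    have hloc : IsLocalMin (fun z => (chebPoly fun k => (t k : ℝ)).eval z) a := by
      filter_upwards [Icc_mem_nhds hlt2 hlt1] with z hz using hmin hz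
    have := hloc.hasDerivAt_eq_zero ((chebPoly fun k => (t k : ℝ)).hasDerivAt a)
    rwa [← hmap, derivative_map, eval_map_algebraMap] at this
  refine hkey.trans (mul_le_mul_of_nonneg_left ?_ (by linarith))
  rw [heval]
  exact hmin hz

end IntegerChebyshev

/-! ### Positive semidefinite matrices and a Newton-type estimate. -/

section RealMatrices

open Matrix
open scoped MatrixOrder

variable {ι : Type*} [Fintype ι] [DecidableEq ι]

/-- With `A = Sᴴ * S` and `T = S⁻¹`, congruence by `T` normalizes `A` to the identity; all estimates
in the geometry of `A` are reduced to `A = 1` this way. -/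
theorem exists_conjTranspose_mul_mul_eq_one {A : Matrix ι ι ℝ} (hA : A.PosDef) :
    ∃ T : Matrix ι ι ℝ, IsUnit T ∧ Tᴴ * A * T = 1 ∧ A⁻¹ = T * Tᴴ := by
  obtain ⟨S, hS⟩ := CStarAlgebra.nonneg_iff_eq_star_mul_self.mp hA.posSemidef.nonneg
  rw [star_eq_conjTranspose] at hS
  have hSu : IsUnit S.det := by
    have := hA.det_pos
    rw [hS, det_mul] at this
    exact isUnit_iff_ne_zero.2 (right_ne_zero_of_mul this.ne')
  refine ⟨S⁻¹, (isUnit_iff_isUnit_det _).2 (isUnit_nonsing_inv_det _ hSu), ?_, ?_⟩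
  · rw [hS, conjTranspose_nonsing_inv, mul_assoc, mul_assoc, mul_nonsing_inv _ hSu, mul_one,
      nonsing_inv_mul]
    rw [det_conjTranspose]
    exact hSu.star
  · rw [hS, Matrix.mul_inv_rev, conjTranspose_nonsing_inv]

/-- The trace dominates the largest eigenvalue; for `G = Sᴴ * S` this is Cauchy–Schwarz in each row
of `S`. -/
theorem posSemidef_trace_smul_one_sub {G : Matrix ι ι ℝ} (hG : G.PosSemidef) :
    (G.trace • (1 : Matrix ι ι ℝ) - G).PosSemidef := by
  obtain ⟨S, hS⟩ := CStarAlgebra.nonneg_iff_eq_star_mul_self.mp hG.nonneg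
  rw [star_eq_conjTranspose] at hS
  refine PosSemidef.of_dotProduct_mulVec_nonneg ?_ fun x => ?_
  · exact ((isHermitian_one).smul (k := G.trace) (by simp [IsSelfAdjoint])).sub hG.1
  have htr : G.trace = ∑ i, ∑ j, S i j ^ 2 := by
    rw [hS, Finset.sum_comm]
    simp [trace, mul_apply, pow_two]
  have hGx : star x ⬝ᵥ G *ᵥ x = ∑ i, (∑ j, S i j * x j) ^ 2 := by
    rw [hS, ← mulVec_mulVec, dotProduct_mulVec, vecMul_conjTranspose, star_star]
    simp [dotProduct, mulVec, pow_two]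
  have hx : star x ⬝ᵥ x = ∑ j, x j ^ 2 := by simp [dotProduct, pow_two]
  rw [sub_mulVec, dotProduct_sub, smul_mulVec, one_mulVec, dotProduct_smul, hGx, hx, htr,
    smul_eq_mul, Finset.sum_mul, ← Finset.sum_sub_distrib]
  exact Finset.sum_nonneg fun i _ => sub_nonneg.2 (Finset.sum_mul_sq_le_sq_mul_sq _ _ _)

theorem posSemidef_trace_inv_mul_smul_sub {A G : Matrix ι ι ℝ} (hA : A.PosDef)
    (hG : G.PosSemidef) : ((A⁻¹ * G).trace • A - G).PosSemidef := by
  obtain ⟨T, hT, hTA, hAinv⟩ := exists_conjTranspose_mul_mul_eq_one hA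
  rw [← IsUnit.posSemidef_star_left_conjugate_iff hT, star_eq_conjTranspose]
  have h := posSemidef_trace_smul_one_sub (hG.conjTranspose_mul_mul_same T)
  rw [mul_sub, sub_mul, mul_smul_comm, smul_mul_assoc, hTA, hAinv]
  rwa [mul_assoc T, trace_mul_comm T]

/-- The quadratic forms are tested at `e i + e j` and `e i - e j`; pairing opposite inequalities
cancels the diagonal entries of `D`. -/
theorem abs_apply_le_of_posSemidef {D : Matrix ι ι ℝ} {κ : ℝ}
    (h1 : (κ • (1 : Matrix ι ι ℝ) - D).PosSemidef) (h2 : (κ • (1 : Matrix ι ι ℝ) + D).PosSemidef)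
    (i j : ι) : |D i j| ≤ κ := by
  have hD : D j i = D i j := by
    have := h2.1.apply i j
    by_cases hij : i = j
    · rw [hij]
    · simpa [hij, Ne.symm hij] using this
  have key : ∀ c : ℝ, 0 ≤ κ * (1 + 2 * c * (1 : Matrix ι ι ℝ) i j + c ^ 2) -
      (D i i + 2 * c * D i j + c ^ 2 * D j j) ∧
      0 ≤ κ * (1 + 2 * c * (1 : Matrix ι ι ℝ) i j + c ^ 2) +
      (D i i + 2 * c * D i j + c ^ 2 * D j j) := by
    intro c
    have e1 := h1.dotProduct_mulVec_nonneg (Pi.single i 1 + c • Pi.single j 1)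
    have e2 := h2.dotProduct_mulVec_nonneg (Pi.single i 1 + c • Pi.single j 1)
    have h1' : (1 : Matrix ι ι ℝ) j i = (1 : Matrix ι ι ℝ) i j := by
      simp [one_apply, eq_comm]
    simp only [star_trivial, mulVec_add, mulVec_smul, add_dotProduct, dotProduct_add,
      smul_dotProduct, dotProduct_smul, single_one_dotProduct, mulVec_single_one, col_apply,
      Matrix.sub_apply, Matrix.add_apply, Matrix.smul_apply, smul_eq_mul, hD, h1',
      one_apply_eq] at e1 e2
    exact ⟨by linarith, by linarith⟩
  obtain ⟨a1, a2⟩ := key 1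
  obtain ⟨b1, b2⟩ := key (-1)
  rw [abs_le]
  constructor <;> linarith

section Frobenius

attribute [local instance] Matrix.frobeniusNormedAddCommGroup Matrix.frobeniusNormedSpace

theorem frobenius_norm_sq {m : Type*} [Fintype m] (A : Matrix m m ℝ) :
    ‖A‖ ^ 2 = ∑ i, ∑ j, A i j ^ 2 := by
  rw [frobenius_norm_def, ← Real.sqrt_eq_rpow, Real.sq_sqrt (by positivity)]
  simp

theorem trace_mul_le_frobenius {m : Type*} [Fintype m] (A B : Matrix m m ℝ) :
    (A * B).trace ≤ ‖A‖ * ‖B‖ := by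
  refine abs_le_of_sq_le_sq' ?_ (by positivity) |>.2
  rw [mul_pow, frobenius_norm_sq, frobenius_norm_sq, trace]
  simp only [diag_apply, mul_apply]
  rw [Finset.sum_comm (f := fun i j => B i j ^ 2)]
  simp only [← Finset.sum_product']
  exact Finset.sum_mul_sq_le_sq_mul_sq _ _ _

theorem posSemidef_one_add_of_frobenius_norm_le {U : Matrix ι ι ℝ} (hU : U.IsHermitian)
    (h : ‖U‖ ≤ 1) : (1 + U).PosSemidef := by
  refine PosSemidef.of_dotProduct_mulVec_nonneg (isHermitian_one.add hU) fun x => ?_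
  have hx : star x ⬝ᵥ x = ∑ j, x j ^ 2 := by simp [dotProduct, pow_two]
  have hUx : star x ⬝ᵥ U *ᵥ x = ∑ p ∈ Finset.univ ×ˢ Finset.univ, U p.1 p.2 * (x p.1 * x p.2) := by
    rw [Finset.sum_product]
    simp only [dotProduct, mulVec, star_trivial, Finset.mul_sum]
    exact Finset.sum_congr rfl fun i _ => Finset.sum_congr rfl fun j _ => by ring
  have hsq : (star x ⬝ᵥ U *ᵥ x) ^ 2 ≤ (∑ j, x j ^ 2) ^ 2 := by
    rw [hUx]
    refine (Finset.sum_mul_sq_le_sq_mul_sq _ _ _).trans ?_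
    have e1 : ∑ p ∈ (Finset.univ : Finset ι) ×ˢ (Finset.univ : Finset ι), U p.1 p.2 ^ 2 ≤ 1 := by
      rw [Finset.sum_product]
      refine (frobenius_norm_sq U).symm.le.trans ?_
      exact pow_le_one₀ (norm_nonneg _) h
    have e2 : ∑ p ∈ (Finset.univ : Finset ι) ×ˢ (Finset.univ : Finset ι), (x p.1 * x p.2) ^ 2 =
        (∑ j, x j ^ 2) ^ 2 := by
      rw [Finset.sum_product, pow_two, Finset.sum_mul_sum]
      simp [mul_pow]
    rw [e2]
    exact mul_le_of_le_one_left (by positivity) e1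
  rw [add_mulVec, one_mulVec, dotProduct_add, hx]
  have := (abs_le_of_sq_le_sq' hsq (by positivity)).1
  linarith

theorem frobenius_norm_le_of_abs_apply_le {m : Type*} [Fintype m] {D : Matrix m m ℝ} {κ : ℝ}
    (hκ : 0 ≤ κ) (h : ∀ i j, |D i j| ≤ κ) : ‖D‖ ≤ Fintype.card m * κ := by
  refine abs_le_of_sq_le_sq' ?_ (by positivity) |>.2
  rw [frobenius_norm_sq, mul_pow]
  refine (Finset.sum_le_sum fun i _ => Finset.sum_le_sum fun j _ =>
    sq_le_sq' (abs_le.1 (h i j)).1 (abs_le.1 (h i j)).2).trans ?_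
  simp [pow_two, mul_assoc]

/-- The Newton-type estimate behind dual certificates, for matrices near the identity. -/
theorem posSemidef_one_add_of_trace_eq {D U : Matrix ι ι ℝ} (hD : ‖D‖ ≤ 1 / 2)
    (hU : U.IsHermitian) (hB : IsUnit (1 - D))
    (htr : (U * U).trace = (((1 - D)⁻¹ - 1) * U).trace) : (1 + U).PosSemidef := by
  refine posSemidef_one_add_of_frobenius_norm_le hU ?_
  set E := (1 - D)⁻¹ - 1 with hE
  -- This Neumann-type identity gives `‖E‖ ≤ ‖D‖ / (1 - ‖D‖) ≤ 1`. Then `‖U‖ ^ 2 = tr (E * U) ≤ ‖U‖`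
  -- yields `‖U‖ ≤ 1`.
  have hEq : E = D + D * E := by
    have h1 : (1 - D) * (1 - D)⁻¹ = 1 := mul_nonsing_inv _ ((isUnit_iff_isUnit_det _).1 hB)
    have h2 : (1 - D)⁻¹ = E + 1 := by rw [hE]; abel
    rw [h2, sub_mul, one_mul, mul_add, mul_one, sub_eq_iff_eq_add] at h1
    have h3 : E + 1 = D + D * E + 1 := by rw [h1]; abel
    exact add_right_cancel h3
  have hEn : ‖E‖ ≤ 1 := by
    have h1 : ‖E‖ ≤ ‖D‖ + ‖D‖ * ‖E‖ := by
      conv_lhs => rw [hEq]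
      exact (norm_add_le _ _).trans (add_le_add_right (frobenius_norm_mul _ _) _)
    have := mul_le_mul_of_nonneg_right hD (norm_nonneg E)
    linarith
  have hsq : ‖U‖ ^ 2 ≤ ‖U‖ := by
    have h1 : ‖U‖ ^ 2 = (U * U).trace := by
      rw [frobenius_norm_sq]
      simp only [trace, diag_apply, mul_apply]
      refine Finset.sum_congr rfl fun i _ => Finset.sum_congr rfl fun j _ => ?_
      have := hU.apply i j
      rw [star_trivial] at this
      rw [this, pow_two]
    rw [h1, htr]
    exact (trace_mul_le_frobenius _ _).trans
      (mul_le_of_le_one_left (norm_nonneg _) hEn)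
  by_contra! hcon
  nlinarith

/-- If `B` is close to `A` in the geometry of `A`, and the direction `U` satisfies the Newton
equation at `A` with the right-hand side `B⁻¹ - A⁻¹`, then the step leads to a positive
semidefinite matrix. -/
theorem posSemidef_add_of_trace_eq {A B U : Matrix ι ι ℝ} {κ : ℝ} (hA : A.PosDef)
    (hB : B.PosDef) (hU : U.IsHermitian) (hκ0 : 0 ≤ κ) (hκ : Fintype.card ι * κ ≤ 1 / 2)
    (h1 : (κ • A - (A - B)).PosSemidef) (h2 : (κ • A + (A - B)).PosSemidef)
    (htr : (A⁻¹ * U * A⁻¹ * U).trace = (B⁻¹ * U).trace - (A⁻¹ * U).trace) :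
    (A + U).PosSemidef := by
  obtain ⟨T, hT, hTA, hAinv⟩ := exists_conjTranspose_mul_mul_eq_one hA
  have hTd := (isUnit_iff_isUnit_det _).1 hT
  have hTHd : IsUnit (Tᴴ).det := by rw [det_conjTranspose]; exact hTd.star
  -- Congruence by `T` turns `A` into `1` and `B` into `1 - D` with `D = Tᴴ * (A - B) * T`. The two
  -- semidefinite bounds become entrywise bounds by `κ`, so the Frobenius norm of `D` is at most the
  -- order times `κ`.
  rw [← IsUnit.posSemidef_star_left_conjugate_iff hT, star_eq_conjTranspose, mul_add, add_mul,
    hTA]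
  have hBT : Tᴴ * B * T = 1 - Tᴴ * (A - B) * T := by
    rw [mul_sub, sub_mul, hTA]; abel
  have k1 : (κ • (1 : Matrix ι ι ℝ) - Tᴴ * (A - B) * T).PosSemidef := by
    have := h1.conjTranspose_mul_mul_same T
    rwa [mul_sub Tᴴ (κ • A), sub_mul, mul_smul_comm, smul_mul_assoc, hTA] at this
  have k2 : (κ • (1 : Matrix ι ι ℝ) + Tᴴ * (A - B) * T).PosSemidef := by
    have := h2.conjTranspose_mul_mul_same T
    rwa [mul_add Tᴴ (κ • A), add_mul, mul_smul_comm, smul_mul_assoc, hTA] at this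
  refine posSemidef_one_add_of_trace_eq (D := Tᴴ * (A - B) * T)
    ((frobenius_norm_le_of_abs_apply_le hκ0 (abs_apply_le_of_posSemidef k1 k2)).trans hκ)
    (isHermitian_conjTranspose_mul_mul _ hU) ?_ ?_
  · rw [← hBT]
    exact ((isUnit_iff_isUnit_det _).2 hTHd).mul hB.isUnit |>.mul hT
  rw [← hBT, Matrix.mul_inv_rev, Matrix.mul_inv_rev, sub_mul, one_mul, trace_sub]
  have t1 : (T⁻¹ * (B⁻¹ * Tᴴ⁻¹) * (Tᴴ * U * T)).trace = (B⁻¹ * U).trace := by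
    have : T⁻¹ * (B⁻¹ * Tᴴ⁻¹) * (Tᴴ * U * T) = T⁻¹ * (B⁻¹ * U * T) := by
      simp only [mul_assoc]
      rw [← mul_assoc Tᴴ⁻¹, nonsing_inv_mul _ hTHd, one_mul]
    rw [this, trace_mul_comm, mul_assoc, mul_nonsing_inv _ hTd, mul_one]
  have t2 : (Tᴴ * U * T).trace = (A⁻¹ * U).trace := by
    rw [hAinv, trace_mul_comm, ← mul_assoc]
  have t3 : (Tᴴ * U * T * (Tᴴ * U * T)).trace = (A⁻¹ * U * A⁻¹ * U).trace := by
    rw [hAinv]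
    simp only [mul_assoc]
    rw [trace_mul_comm T]
    simp only [mul_assoc]
  rw [t1, t2, t3, htr]

end Frobenius

end RealMatrices

/-! ### Gradient and Hessian of `-log det` along a linear map. -/

section LogDet

open Matrix

variable {ι : Type*} [Fintype ι] [DecidableEq ι]

theorem hasDerivAt_det_add_smul {A : Matrix ι ι ℝ} (hA : A.det ≠ 0) (B : Matrix ι ι ℝ) :
    HasDerivAt (fun r : ℝ => (A + r • B).det) (A.det * (A⁻¹ * B).trace) 0 := by
  have hAu : IsUnit A.det := isUnit_iff_ne_zero.2 hA
  -- The determinant is `det A` times a polynomial in `r` of the form `1 + r tr (A⁻¹ * B) + r² (…)`.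
  have h : ∀ r : ℝ, (A + r • B).det = A.det * (1 + (A⁻¹ * B).trace * r +
      (det (1 + (X : ℝ[X]) • (A⁻¹ * B).map C)).divX.divX.eval r * r ^ 2) := fun r => by
    rw [← det_one_add_smul, ← det_mul, mul_add, mul_one, mul_smul_comm, ← mul_assoc,
      mul_nonsing_inv _ hAu, one_mul]
  simp only [h]
  set p := (det (1 + (X : ℝ[X]) • (A⁻¹ * B).map C)).divX.divX
  have := ((((hasDerivAt_id (0 : ℝ)).const_mul (A⁻¹ * B).trace).const_add 1).add
    ((p.hasDerivAt 0).mul ((hasDerivAt_id (0 : ℝ)).pow 2))).const_mul A.det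
  simpa using this

variable {U : ℕ} (Λ : (Fin U → ℝ) →ₗ[ℝ] Matrix ι ι ℝ)

theorem differentiable_det_linearMap : Differentiable ℝ fun x => (Λ x).det := by
  simp only [det_apply']
  have h : ∀ i j, Differentiable ℝ fun x => Λ x i j := fun i j =>
    (LinearMap.toContinuousLinearMap (Matrix.entryLinearMap ℝ ℝ i j ∘ₗ Λ)).differentiable
  fun_prop

theorem fderiv_neg_log_det {x : Fin U → ℝ} (hx : (Λ x).det ≠ 0) (e : Fin U → ℝ) :
    fderiv ℝ (fun y => -Real.log (Λ y).det) x e = -((Λ x)⁻¹ * Λ e).trace := by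
  have hd : DifferentiableAt ℝ (fun y => -Real.log (Λ y).det) x :=
    ((differentiable_det_linearMap Λ x).log hx).neg
  have h1 := hd.hasFDerivAt.hasLineDerivAt e
  have h2 : HasLineDerivAt ℝ (fun y => -Real.log (Λ y).det) (-((Λ x)⁻¹ * Λ e).trace) x e := by
    have h3 := hasDerivAt_det_add_smul hx (Λ e)
    have h4 := (h3.log (by simpa using hx)).neg
    unfold HasLineDerivAt
    simp only [map_add, map_smul]
    convert h4 using 1
    · rfl
    rw [zero_smul, add_zero, mul_div_cancel_left₀ _ hx]
  exact h1.unique h2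

/-- Differentiating inversion needs a normed ring. The ring is abstract here, and a matrix norm is
chosen only when this is applied. -/
theorem exists_hasFDerivAt_linearMap_inverse {R E : Type*} [NormedRing R] [NormedAlgebra ℝ R]
    [FiniteDimensional ℝ R] [NormedAddCommGroup E] [NormedSpace ℝ E] [FiniteDimensional ℝ E]
    (Λ : E →ₗ[ℝ] R) (φ : R →ₗ[ℝ] ℝ) {x : E} (u : Rˣ) (hu : ↑u = Λ x) :
    ∃ D : E →L[ℝ] ℝ, HasFDerivAt (fun y => φ (Ring.inverse (Λ y))) D x ∧
      ∀ e, D e = φ (-(↑u⁻¹ * Λ e * ↑u⁻¹)) := by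
  have : CompleteSpace R := FiniteDimensional.complete ℝ R
  have h1 : HasFDerivAt Ring.inverse (-ContinuousLinearMap.mulLeftRight ℝ R ↑u⁻¹ ↑u⁻¹) (Λ x) := by
    rw [← hu]
    exact hasFDerivAt_ringInverse u
  have h2 := h1.comp x (LinearMap.toContinuousLinearMap Λ).hasFDerivAt
  exact ⟨_, (LinearMap.toContinuousLinearMap φ).hasFDerivAt.comp x h2, fun e => by simp⟩

section

attribute [local instance] Matrix.linftyOpNormedRing Matrix.linftyOpNormedAlgebra

theorem exists_hasFDerivAt_trace_inv_mul {x : Fin U → ℝ} (hx : (Λ x).det ≠ 0)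
    (K : Matrix ι ι ℝ) : ∃ D : (Fin U → ℝ) →L[ℝ] ℝ,
      HasFDerivAt (fun y => ((Λ y)⁻¹ * K).trace) D x ∧
        ∀ e, D e = -((Λ x)⁻¹ * Λ e * (Λ x)⁻¹ * K).trace := by
  obtain ⟨u, hu⟩ := (isUnit_iff_isUnit_det _).2 (isUnit_iff_ne_zero.2 hx)
  obtain ⟨D, hD, hDe⟩ := exists_hasFDerivAt_linearMap_inverse Λ
    (Matrix.traceLinearMap ι ℝ ℝ ∘ₗ LinearMap.mulRight ℝ K) u hu
  have h5 : (↑u⁻¹ : Matrix ι ι ℝ) = (Λ x)⁻¹ := by rw [← hu, coe_units_inv]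
  refine ⟨D, ?_, fun e => ?_⟩
  · simpa [nonsing_inv_eq_ringInverse] using hD
  · rw [hDe, h5]
    simp

end

theorem hessian_neg_log_det {x : Fin U → ℝ} (hx : (Λ x).det ≠ 0) (j k : Fin U) :
    hessian (fun y => -Real.log (Λ y).det) x j k =
      ((Λ x)⁻¹ * Λ (Pi.single j 1) * (Λ x)⁻¹ * Λ (Pi.single k 1)).trace := by
  have hev : (fun y => fderiv ℝ (fun y => -Real.log (Λ y).det) y (Pi.single k 1)) =ᶠ[nhds x]
      fun y => -((Λ y)⁻¹ * Λ (Pi.single k 1)).trace := by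
    have hc : Continuous fun y => (Λ y).det := (differentiable_det_linearMap Λ).continuous
    filter_upwards [hc.continuousAt.eventually_ne hx] with y hy
    exact fderiv_neg_log_det Λ hy _
  obtain ⟨D, hD, hDe⟩ := exists_hasFDerivAt_trace_inv_mul Λ hx (Λ (Pi.single k 1))
  rw [hessian, of_apply, hev.fderiv_eq, fderiv_fun_neg, _root_.neg_apply, hD.fderiv, hDe, neg_neg]

theorem dotProduct_hessian_mulVec {x : Fin U → ℝ} (hx : (Λ x).det ≠ 0) (u v : Fin U → ℝ) :
    u ⬝ᵥ hessian (fun y => -Real.log (Λ y).det) x *ᵥ v =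
      ((Λ x)⁻¹ * Λ u * (Λ x)⁻¹ * Λ v).trace := by
  have hsum : ∀ w : Fin U → ℝ, Λ w = ∑ j, w j • Λ (Pi.single j 1) := fun w => by
    conv_lhs => rw [pi_eq_sum_univ' w, map_sum]
    refine Finset.sum_congr rfl fun j _ => ?_
    rw [map_smul]
  rw [hsum u, hsum v]
  simp only [Finset.mul_sum, Finset.sum_mul, trace_sum, mul_smul_comm, smul_mul_assoc, trace_smul,
    smul_eq_mul, dotProduct, mulVec, hessian_neg_log_det Λ hx]
  rw [Finset.sum_comm]
  refine Finset.sum_congr rfl fun j _ => Finset.sum_congr rfl fun k _ => ?_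
  ring

/-- With `A⁻¹ = T * Tᴴ` the trace is the squared Frobenius norm of `Tᴴ * W * T`. This is the
definiteness of the Hessian. -/
theorem eq_zero_of_trace_inv_mul_eq_zero {A W : Matrix ι ι ℝ} (hA : A.PosDef) (hW : W.IsHermitian)
    (h : (A⁻¹ * W * A⁻¹ * W).trace = 0) : W = 0 := by
  obtain ⟨T, hT, hTA, hAinv⟩ := exists_conjTranspose_mul_mul_eq_one hA
  have hT' : IsUnit Tᴴ := by
    rw [isUnit_iff_isUnit_det, det_conjTranspose]
    exact ((isUnit_iff_isUnit_det _).1 hT).star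
  have hM : (Tᴴ * W * T)ᴴ = Tᴴ * W * T := isHermitian_conjTranspose_mul_mul _ hW
  have h1 : ((Tᴴ * W * T)ᴴ * (Tᴴ * W * T)).trace = 0 := by
    rw [hM, ← h, hAinv]
    simp only [mul_assoc]
    rw [trace_mul_comm T]
    simp only [mul_assoc]
  rw [trace_conjTranspose_mul_self_eq_zero_iff] at h1
  rw [hT.mul_left_eq_zero, hT'.mul_right_eq_zero] at h1
  exact h1

/-- The vector `v = H(x)⁻¹ t` solves the Newton equation `H(x) v = t`. -/
theorem dotProduct_eq_trace_hessian_inv_mulVec (hΛ : ∀ x, (Λ x).IsHermitian)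
    (hinj : Function.Injective Λ) {x : Fin U → ℝ} (hx : (Λ x).PosDef) (t u : Fin U → ℝ) :
    u ⬝ᵥ t = ((Λ x)⁻¹ * Λ u * (Λ x)⁻¹ *
      Λ ((hessian (fun y => -Real.log (Λ y).det) x)⁻¹ *ᵥ t)).trace := by
  have hdet := hx.det_pos.ne'
  rw [← dotProduct_hessian_mulVec Λ hdet, mulVec_mulVec, mul_nonsing_inv, one_mulVec]
  rw [isUnit_iff_ne_zero]
  intro h0
  obtain ⟨v, hv, hv0⟩ := exists_mulVec_eq_zero_iff.2 h0
  have h1 := dotProduct_hessian_mulVec Λ hdet v v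
  rw [hv0, dotProduct_zero] at h1
  have h2 := eq_zero_of_trace_inv_mul_eq_zero hx (hΛ v) h1.symm
  exact hv (hinj (by rw [h2, map_zero]))

end LogDet

/-! ### Coefficient vectors as linear functionals on polynomials. -/

section Functional

theorem repr_chebPoly {U : ℕ} (s : Fin U → ℝ) (u : Fin U) :
    chebBasis.repr (chebPoly s) (u : ℕ) = s u := by
  have h : chebPoly s = ∑ k, s k • chebBasis (k : ℕ) := by simp only [chebBasis_apply, chebPoly]
  rw [h, map_sum, Finsupp.finsetSum_apply]
  simp [Finsupp.single_apply, Fin.val_inj]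

/-- The linear functional on polynomials with the values `x` at the Chebyshev polynomials. -/
def chebFunctional {U : ℕ} (x : Fin U → ℝ) : ℝ[X] →ₗ[ℝ] ℝ :=
  ∑ u : Fin U, x u • (Finsupp.lapply (u : ℕ) ∘ₗ (chebBasis.repr : ℝ[X] →ₗ[ℝ] ℕ →₀ ℝ))

theorem chebFunctional_apply {U : ℕ} (x : Fin U → ℝ) (q : ℝ[X]) :
    chebFunctional x q = ∑ u : Fin U, chebBasis.repr q (u : ℕ) * x u := by
  simp [chebFunctional, LinearMap.sum_apply, mul_comm]

theorem chebFunctional_chebPoly {U : ℕ} (x s : Fin U → ℝ) :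
    chebFunctional x (chebPoly s) = s ⬝ᵥ x := by
  simp [chebFunctional_apply, repr_chebPoly, dotProduct]

theorem exists_chebPoly_eq {N : ℕ} {q : ℝ[X]} (hq : q.natDegree ≤ N) :
    ∃ s : Fin (N + 1) → ℝ, chebPoly s = q := by
  induction N generalizing q with
  | zero =>
    refine ⟨fun _ => q.coeff 0, ?_⟩
    conv_rhs => rw [eq_C_of_natDegree_le_zero hq]
    simp [chebPoly, smul_eq_C_mul]
  | succ N ih =>
    set T := Chebyshev.T ℝ ((N + 1 : ℕ) : ℤ)
    have hT : T.natDegree = N + 1 := by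
      rw [Chebyshev.natDegree_T, Int.natAbs_natCast]
    have hlc : T.coeff (N + 1) ≠ 0 := by
      rw [← hT, coeff_natDegree, leadingCoeff_ne_zero]
      exact Chebyshev.T_ne_zero _ _
    set c := q.coeff (N + 1) / T.coeff (N + 1)
    have hdeg : (q - c • T).natDegree ≤ N := by
      rw [natDegree_le_iff_coeff_eq_zero]
      intro m hm
      rcases Nat.lt_or_ge (N + 1) m with h | h
      · rw [coeff_sub, coeff_smul, coeff_eq_zero_of_natDegree_lt (by omega),
          coeff_eq_zero_of_natDegree_lt (by omega)]
        simp
      · obtain rfl : m = N + 1 := by omega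
        rw [coeff_sub, coeff_smul, smul_eq_mul, div_mul_cancel₀ _ hlc, sub_self]
    obtain ⟨s, hs⟩ := ih hdeg
    refine ⟨Fin.snoc s c, ?_⟩
    rw [chebPoly, Fin.sum_univ_castSucc]
    simp only [Fin.snoc_castSucc, Fin.snoc_last, Fin.val_castSucc, Fin.val_last]
    rw [chebPoly] at hs
    rw [hs]
    exact sub_add_cancel _ _

end Functional

/-! ### Degree bounds and the order of `Λ`. -/

section Degrees

theorem natDegree_le_of_mem_degreeLT {n : ℕ} {r : ℝ[X]} (hr : r ∈ degreeLT ℝ (n + 1)) :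
    r.natDegree ≤ n := by
  rw [mem_degreeLT] at hr
  by_cases h : r = 0
  · simp [h]
  rw [degree_eq_natDegree h] at hr
  exact Nat.lt_succ_iff.1 (by exact_mod_cast hr)

theorem natDegree_intervalWeights_mul_sq_le {N : ℕ} {i : Fin 2} {r : ℝ[X]}
    (hr : r ∈ degreeLT ℝ (intervalDims N i)) : (intervalWeights N i * r ^ 2).natDegree ≤ N := by
  obtain ⟨d, rfl | rfl⟩ := Nat.even_or_odd' N
  · rw [intervalDims_even] at hr
    rw [intervalWeights_even]
    fin_cases i
    · have h := natDegree_le_of_mem_degreeLT (n := d) (by simpa using hr)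
      have := natDegree_pow_le (p := r) (n := 2)
      simp only [Fin.zero_eta, Matrix.cons_val_zero, one_mul]
      omega
    · rcases d with - | d
      · have h0 : r = 0 := by simpa [mem_degreeLT] using hr
        simp [h0]
      · have h := natDegree_le_of_mem_degreeLT (n := d) (by simpa using hr)
        have h1 := natDegree_pow_le (p := r) (n := 2)
        have h2 : (1 - X ^ 2 : ℝ[X]).natDegree ≤ 2 := by compute_degree
        have h3 := natDegree_mul_le (p := (1 - X ^ 2 : ℝ[X])) (q := r ^ 2)
        simp only [Fin.mk_one, Matrix.cons_val_one, Matrix.cons_val_fin_one]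
        omega
  · rw [intervalDims_odd] at hr
    rw [intervalWeights_odd]
    have h1 := natDegree_pow_le (p := r) (n := 2)
    fin_cases i
    · have h := natDegree_le_of_mem_degreeLT (n := d) (by simpa using hr)
      have h2 := natDegree_one_sub_X_le
      have h3 := natDegree_mul_le (p := (1 - X : ℝ[X])) (q := r ^ 2)
      simp only [Fin.zero_eta, Matrix.cons_val_zero]
      omega
    · have h := natDegree_le_of_mem_degreeLT (n := d) (by simpa using hr)
      have h2 := natDegree_one_add_X_le
      have h3 := natDegree_mul_le (p := (1 + X : ℝ[X])) (q := r ^ 2)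
      simp only [Fin.mk_one, Matrix.cons_val_one, Matrix.cons_val_fin_one]
      omega

/-- The order of `Λ` is the trace of the identity. It is the normalization of the gradient point and
the dimension factor in the Frobenius estimate. -/
theorem card_sigma_intervalDims (N : ℕ) : Fintype.card (Σ i, Fin (intervalDims N i)) = N + 1 := by
  obtain ⟨d, rfl | rfl⟩ := Nat.even_or_odd' N
  · simp [intervalDims_even]; omega
  · simp [intervalDims_odd]; omega

end Degrees

/-! ### The dual cone as the preimage of the positive semidefinite cone. -/

section Cone

open Matrix

/-- The cone of the weighted sums of squares on `[-1, 1]`. -/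
abbrev intervalCone (N : ℕ) : Set (Fin (N + 1) → ℝ) :=
  wsosCone (intervalWeights N) (intervalDims N) (N + 1)

theorem mem_intervalCone_iff_nonneg {N : ℕ} {s : Fin (N + 1) → ℝ} :
    s ∈ intervalCone N ↔ ∀ z ∈ Set.Icc (-1 : ℝ) 1, 0 ≤ (chebPoly s).eval z :=
  ⟨fun h _ hz => IsIntervalSOS.eval_nonneg h hz,
    fun h => isIntervalSOS_of_nonneg N _ (natDegree_chebPoly_le s) h⟩

variable {N : ℕ} (p : ∀ i : Fin 2, Module.Basis (Fin (intervalDims N i)) ℝ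
  (degreeLT ℝ (intervalDims N i)))

/-- The map `Λ` for the interval, as a linear map. -/
def intervalLam : (Fin (N + 1) → ℝ) →ₗ[ℝ]
    Matrix (Σ i, Fin (intervalDims N i)) (Σ i, Fin (intervalDims N i)) ℝ where
  toFun := lam (intervalWeights N) p
  map_add' x y := by
    rw [lam, lam, lam, ← blockDiagonal'_add]
    congr 1
    ext i j k
    simp [lamBlock, mul_add, Finset.sum_add_distrib]
  map_smul' c x := by
    rw [RingHom.id_apply, lam, lam, ← blockDiagonal'_smul]
    congr 1
    ext i j k
    simp only [lamBlock, of_apply, Pi.smul_apply, Matrix.smul_apply, smul_eq_mul, Finset.mul_sum]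
    exact Finset.sum_congr rfl fun u _ => by ring

theorem intervalLam_apply (x : Fin (N + 1) → ℝ) : intervalLam p x = lam (intervalWeights N) p x :=
  rfl

theorem lamBlock_apply (x : Fin (N + 1) → ℝ) (i : Fin 2) (j k : Fin (intervalDims N i)) :
    lamBlock (intervalWeights N) p i x j k =
      chebFunctional x (intervalWeights N i * (p i j : ℝ[X]) * (p i k : ℝ[X])) := by
  rw [chebFunctional_apply, lamBlock, of_apply]

theorem intervalLam_isHermitian (x : Fin (N + 1) → ℝ) : (intervalLam p x).IsHermitian := by
  rw [intervalLam_apply, lam, IsHermitian, blockDiagonal'_conjTranspose]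
  congr 1
  ext i j k
  rw [conjTranspose_apply, star_trivial, lamBlock_apply, lamBlock_apply, mul_right_comm]

theorem dotProduct_lamBlock_mulVec (x : Fin (N + 1) → ℝ) (i : Fin 2)
    (c : Fin (intervalDims N i) → ℝ) :
    c ⬝ᵥ lamBlock (intervalWeights N) p i x *ᵥ c =
      chebFunctional x (intervalWeights N i * ((∑ j, c j • p i j : degreeLT ℝ _) : ℝ[X]) ^ 2) := by
  have h : intervalWeights N i * ((∑ j, c j • p i j : degreeLT ℝ _) : ℝ[X]) ^ 2 =
      ∑ j, ∑ k, (c j * c k) • (intervalWeights N i * (p i j : ℝ[X]) * (p i k : ℝ[X])) := by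
    rw [Submodule.coe_sum, pow_two, Finset.sum_mul_sum, Finset.mul_sum]
    refine Finset.sum_congr rfl fun j _ => ?_
    rw [Finset.mul_sum]
    refine Finset.sum_congr rfl fun k _ => ?_
    simp only [Submodule.coe_smul, smul_eq_C_mul, C_mul]
    ring
  rw [h, map_sum]
  simp only [map_sum, map_smul, dotProduct, mulVec, Finset.mul_sum, lamBlock_apply, smul_eq_mul]
  exact Finset.sum_congr rfl fun j _ => Finset.sum_congr rfl fun k _ => by ring

theorem dotProduct_lam_mulVec (x : Fin (N + 1) → ℝ) (c : (Σ i, Fin (intervalDims N i)) → ℝ) :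
    c ⬝ᵥ intervalLam p x *ᵥ c =
      ∑ i, (fun j => c ⟨i, j⟩) ⬝ᵥ lamBlock (intervalWeights N) p i x *ᵥ (fun j => c ⟨i, j⟩) := by
  simp only [intervalLam_apply, lam, dotProduct, mulVec, Fintype.sum_sigma]
  refine Finset.sum_congr rfl fun i _ => Finset.sum_congr rfl fun j _ => ?_
  congr 1
  rw [Finset.sum_eq_single i]
  · simp [blockDiagonal'_apply_eq]
  · intro b _ hb
    exact Finset.sum_eq_zero fun k _ => by rw [blockDiagonal'_apply_ne _ _ _ hb.symm, zero_mul]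
  · simp

/-- The quadratic form of block `i` at the coordinates of `r` is the functional `x` applied to `wᵢ
r²`, and these polynomials generate the cone. -/
theorem posSemidef_intervalLam_iff (x : Fin (N + 1) → ℝ) :
    (intervalLam p x).PosSemidef ↔ x ∈ dualCone (intervalCone N) := by
  constructor
  · intro h s hs
    obtain ⟨σ, hσ, hs⟩ := hs
    rw [← chebFunctional_chebPoly, hs, map_sum]
    refine Finset.sum_nonneg fun i _ => ?_
    obtain ⟨k, r, hr, hσi⟩ := hσ i
    rw [hσi, Finset.mul_sum, map_sum]
    refine Finset.sum_nonneg fun j _ => ?_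
    have hrep := (p i).sum_repr ⟨r j, hr j⟩
    -- The test vector carries the coordinates of `r j` in block `i` and vanishes in the other
    -- block.
    have h1 := h.dotProduct_mulVec_nonneg
      (fun a => if h : a.1 = i then (p i).repr ⟨r j, hr j⟩ (h ▸ a.2) else 0)
    rw [star_trivial, dotProduct_lam_mulVec, Finset.sum_eq_single i] at h1
    · simp only [dite_true] at h1
      rw [dotProduct_lamBlock_mulVec, hrep] at h1
      exact h1
    · intro b _ hb
      simp only [hb, dite_false]
      exact zero_dotProduct _
    · simp
  · intro h
    refine PosSemidef.of_dotProduct_mulVec_nonneg (intervalLam_isHermitian p x) fun c => ?_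
    rw [star_trivial, dotProduct_lam_mulVec]
    simp only [dotProduct_lamBlock_mulVec]
    rw [← map_sum]
    set r : Fin 2 → ℝ[X] := fun i => ((∑ j, c ⟨i, j⟩ • p i j : degreeLT ℝ _) : ℝ[X])
    have hr : ∀ i, r i ∈ degreeLT ℝ (intervalDims N i) := fun i => Submodule.coe_mem _
    obtain ⟨s, hs⟩ := exists_chebPoly_eq (N := N) (q := ∑ i, intervalWeights N i * r i ^ 2)
      (natDegree_sum_le_of_forall_le _ _ fun i _ => natDegree_intervalWeights_mul_sq_le (hr i))
    change 0 ≤ chebFunctional x (∑ i, intervalWeights N i * r i ^ 2)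
    rw [← hs, chebFunctional_chebPoly]
    exact h s ⟨fun i => r i ^ 2, fun i => IsSOS.sq (hr i), hs⟩

end Cone

/-! ### Coefficient bounds from the orthogonality of Chebyshev polynomials. -/

section ChebyshevMeasure

open MeasureTheory Chebyshev

theorem integral_eval_nonneg {q : ℝ[X]} (hq : ∀ z ∈ Set.Icc (-1 : ℝ) 1, 0 ≤ q.eval z) :
    0 ≤ ∫ z, q.eval z ∂measureT := by
  rw [integral_measureT_eq_integral_cos]
  exact intervalIntegral.integral_nonneg Real.pi_nonneg fun x _ => hq _ (Real.cos_mem_Icc x)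

theorem integral_chebPoly_mul_T {U : ℕ} (s : Fin U → ℝ) (k : Fin U) :
    ∫ z, (chebPoly s * T ℝ ((k : ℕ) : ℤ)).eval z ∂measureT =
      s k * ∫ z, (T ℝ ((k : ℕ) : ℤ)).eval z * (T ℝ ((k : ℕ) : ℤ)).eval z ∂measureT := by
  have h : ∀ z : ℝ, (chebPoly s * T ℝ ((k : ℕ) : ℤ)).eval z =
      ∑ j, s j * ((T ℝ ((j : ℕ) : ℤ)).eval z * (T ℝ ((k : ℕ) : ℤ)).eval z) := fun z => by
    simp [chebPoly, eval_finsetSum, Finset.sum_mul]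
  simp only [h]
  rw [integral_finsetSum _ fun j _ => integrable_measureT (by fun_prop)]
  rw [Finset.sum_eq_single k]
  · rw [integral_const_mul]
  · intro j _ hj
    rw [integral_const_mul, integral_eval_T_real_mul_eval_T_real_measureT_of_ne, mul_zero]
    exact fun h => hj (Fin.ext h)
  · simp

/-- The polynomials `s * (1 ± Tₖ)` are nonnegative on `[-1, 1]`, so their integrals against the
Chebyshev measure are too. The factor `2` is the ratio of `∫ T₀² = π` to `∫ Tₖ² = π / 2`. -/
theorem abs_le_two_mul_of_mem_intervalCone {N : ℕ} {s : Fin (N + 1) → ℝ} (hs : s ∈ intervalCone N)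
    (k : Fin (N + 1)) : |s k| ≤ 2 * s 0 := by
  have hpos := mem_intervalCone_iff_nonneg.1 hs
  have h0 := integral_chebPoly_mul_T s 0
  rw [show (((0 : Fin (N + 1)) : ℕ) : ℤ) = 0 by simp,
    integral_eval_T_real_mul_self_measureT_zero] at h0
  rcases eq_or_ne k 0 with rfl | hk
  · have : 0 ≤ s 0 * Real.pi := by
      rw [← h0]
      exact integral_eval_nonneg fun z hz => by simpa using hpos z hz
    have := nonneg_of_mul_nonneg_left this Real.pi_pos
    rw [abs_of_nonneg this]
    linarith
  have h1 := integral_chebPoly_mul_T s k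
  rw [integral_T_real_mul_self_measureT_of_ne_zero fun h => hk (Fin.ext h)] at h1
  have hint : ∀ q : ℝ[X], Integrable (fun z => q.eval z) measureT := fun q =>
    integrable_measureT (by fun_prop)
  have hT : ∀ z ∈ Set.Icc (-1 : ℝ) 1, |(T ℝ ((k : ℕ) : ℤ)).eval z| ≤ 1 := fun z hz =>
    abs_eval_T_real_le_one _ (abs_le.2 hz)
  have hadd := integral_add (hint (chebPoly s * T ℝ 0)) (hint (chebPoly s * T ℝ ((k : ℕ) : ℤ)))
  have hsub := integral_sub (hint (chebPoly s * T ℝ 0)) (hint (chebPoly s * T ℝ ((k : ℕ) : ℤ)))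
  simp only [← eval_add, ← eval_sub, ← mul_add, ← mul_sub] at hadd hsub
  have hadd0 := integral_eval_nonneg (q := chebPoly s * (T ℝ 0 + T ℝ ((k : ℕ) : ℤ))) fun z hz => by
    rw [eval_mul, eval_add, T_zero, eval_one]
    exact mul_nonneg (hpos z hz) (by linarith [(abs_le.1 (hT z hz)).1])
  have hsub0 := integral_eval_nonneg (q := chebPoly s * (T ℝ 0 - T ℝ ((k : ℕ) : ℤ))) fun z hz => by
    rw [eval_mul, eval_sub, T_zero, eval_one]
    exact mul_nonneg (hpos z hz) (by linarith [(abs_le.1 (hT z hz)).2])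
  rw [hadd, h0, h1] at hadd0
  rw [hsub, h0, h1] at hsub0
  have hπ := Real.pi_pos
  rw [abs_le]
  constructor <;> nlinarith

end ChebyshevMeasure

/-! ### The interior of the dual cone and the gradient point of `t`. -/

section DualCone

open Matrix

theorem dualCone_add_mem {U : ℕ} {K : Set (Fin U → ℝ)} {x y : Fin U → ℝ} (hx : x ∈ dualCone K)
    (hy : y ∈ dualCone K) : x + y ∈ dualCone K := fun s hs => by
  rw [dotProduct_add]
  exact add_nonneg (hx s hs) (hy s hs)

theorem dualCone_smul_mem {U : ℕ} {K : Set (Fin U → ℝ)} {x : Fin U → ℝ} (hx : x ∈ dualCone K)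
    {c : ℝ} (hc : 0 ≤ c) : c • x ∈ dualCone K := fun s hs => by
  rw [dotProduct_smul]
  exact mul_nonneg hc (hx s hs)

theorem isClosed_dualCone {U : ℕ} (K : Set (Fin U → ℝ)) : IsClosed (dualCone K) := by
  have : dualCone K = ⋂ s ∈ K, {y | 0 ≤ s ⬝ᵥ y} := by ext; simp [dualCone]
  rw [this]
  refine isClosed_biInter fun s _ => isClosed_le continuous_const ?_
  unfold dotProduct
  fun_prop

variable {N : ℕ}

/-- The coefficient vector of the constant polynomial `1`. -/
abbrev oneVec (N : ℕ) : Fin (N + 1) → ℝ := Pi.single 0 1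

theorem chebPoly_single (k : Fin (N + 1)) (c : ℝ) :
    chebPoly (Pi.single k c) = c • Chebyshev.T ℝ ((k : ℕ) : ℤ) := by
  rw [chebPoly, Finset.sum_eq_single k]
  · simp
  · intro j _ hj
    simp [hj]
  · simp

theorem chebPoly_add (s t : Fin (N + 1) → ℝ) : chebPoly (s + t) = chebPoly s + chebPoly t := by
  simp [chebPoly, add_smul, Finset.sum_add_distrib]

theorem chebPoly_oneVec : chebPoly (oneVec N) = 1 := by
  simp [oneVec, chebPoly_single]

theorem oneVec_add_single_mem_intervalCone (k : Fin (N + 1)) {c : ℝ} (hc : |c| ≤ 1) :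
    oneVec N + Pi.single k c ∈ intervalCone N := by
  refine mem_intervalCone_iff_nonneg.2 fun z hz => ?_
  have hT := Chebyshev.abs_eval_T_real_le_one ((k : ℕ) : ℤ) (abs_le.2 hz)
  have : |c * (Chebyshev.T ℝ ((k : ℕ) : ℤ)).eval z| ≤ 1 := by
    rw [abs_mul]
    exact mul_le_one₀ hc (abs_nonneg _) hT
  rw [chebPoly_add, chebPoly_oneVec, chebPoly_single, eval_add, eval_one, eval_smul, smul_eq_mul]
  linarith [(abs_le.1 this).1]

theorem abs_le_of_mem_dualCone {x : Fin (N + 1) → ℝ} (hx : x ∈ dualCone (intervalCone N))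
    (k : Fin (N + 1)) : |x k| ≤ x 0 := by
  have h1 := hx _ (oneVec_add_single_mem_intervalCone k (c := 1) (by simp))
  have h2 := hx _ (oneVec_add_single_mem_intervalCone k (c := -1) (by simp))
  rw [add_dotProduct, single_dotProduct, single_dotProduct] at h1 h2
  rw [abs_le]
  constructor <;> linarith

/-- The vector of the polynomial `1` lies well inside the dual cone: it pairs with `s` to `s 0`,
which controls all coefficients of `s`. This converts coordinatewise rounding errors into
semidefinite bounds. -/
theorem smul_oneVec_add_mem_dualCone {e : Fin (N + 1) → ℝ} {r c : ℝ} (he : ∀ k, |e k| ≤ r)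
    (hc : (N + 1) * (2 * r) ≤ c) : c • oneVec N + e ∈ dualCone (intervalCone N) := fun s hs => by
  have h := abs_le_two_mul_of_mem_intervalCone hs
  have h0 : 0 ≤ s 0 := by have := (abs_nonneg _).trans (h 0); linarith
  rw [dotProduct_add, dotProduct_smul, dotProduct_single, mul_one, smul_eq_mul]
  have h1 : |s ⬝ᵥ e| ≤ (N + 1) * (2 * s 0 * r) := by
    refine (Finset.abs_sum_le_sum_abs _ _).trans ?_
    refine (Finset.sum_le_card_nsmul _ _ (2 * s 0 * r) fun k _ => ?_).trans (by simp)
    rw [abs_mul]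
    exact mul_le_mul (h k) (he k) (abs_nonneg _) (by linarith)
  have h2 := mul_le_mul_of_nonneg_right hc h0
  have h3 := (abs_le.1 h1).1
  linarith

theorem oneVec_mem_dualCone : oneVec N ∈ dualCone (intervalCone N) := by
  have := smul_oneVec_add_mem_dualCone (N := N) (e := 0) (r := 0) (c := 1) (by simp) (by simp)
  simpa using this

variable (p : ∀ i : Fin 2, Module.Basis (Fin (intervalDims N i)) ℝ
  (degreeLT ℝ (intervalDims N i)))

/-- If `Λ x = 0`, then both `x` and `-x` lie in the dual cone, whose elements are dominated by their
coordinate `0`. -/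
theorem intervalLam_injective : Function.Injective (intervalLam p) := by
  rw [injective_iff_map_eq_zero]
  intro x hx
  have h1 := (posSemidef_intervalLam_iff p x).1 (by rw [hx]; exact PosSemidef.zero)
  have h2 := (posSemidef_intervalLam_iff p (-x)).1 (by
    rw [map_neg, hx, neg_zero]; exact PosSemidef.zero)
  have h3 := abs_le_of_mem_dualCone h1
  have h4 := abs_le_of_mem_dualCone h2
  have h0 : x 0 = 0 := by
    have a := (abs_nonneg _).trans (h3 0)
    have b := (abs_nonneg _).trans (h4 0)
    rw [Pi.neg_apply] at b
    linarith
  funext k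
  simpa [h0] using h3 k

/-- A null vector gives a polynomial `∑ wᵢ rᵢ²` in the cone with zero constant coefficient, hence
the zero polynomial. As the weights are positive on the open interval, all `rᵢ` vanish. -/
theorem intervalLam_oneVec_posDef : (intervalLam p (oneVec N)).PosDef := by
  refine PosDef.of_dotProduct_mulVec_pos (intervalLam_isHermitian p _) fun c hc => ?_
  refine lt_of_le_of_ne
    (((posSemidef_intervalLam_iff p _).2 oneVec_mem_dualCone).dotProduct_mulVec_nonneg c) ?_
  intro h0
  refine hc ?_
  rw [star_trivial, dotProduct_lam_mulVec] at h0
  simp only [dotProduct_lamBlock_mulVec] at h0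
  rw [← map_sum] at h0
  set r : Fin 2 → ℝ[X] := fun i => ((∑ j, c ⟨i, j⟩ • p i j : degreeLT ℝ _) : ℝ[X]) with hr_def
  have hr : ∀ i, r i ∈ degreeLT ℝ (intervalDims N i) := fun i => Submodule.coe_mem _
  obtain ⟨s, hs⟩ := exists_chebPoly_eq (N := N) (q := ∑ i, intervalWeights N i * r i ^ 2)
    (natDegree_sum_le_of_forall_le _ _ fun i _ => natDegree_intervalWeights_mul_sq_le (hr i))
  have hsc : s ∈ intervalCone N := ⟨fun i => r i ^ 2, fun i => IsSOS.sq (hr i), hs⟩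
  change 0 = chebFunctional (oneVec N) (∑ i, intervalWeights N i * r i ^ 2) at h0
  rw [← hs, chebFunctional_chebPoly, dotProduct_single, mul_one] at h0
  have hs0 : s = 0 := by
    funext k
    have := abs_le_two_mul_of_mem_intervalCone hsc k
    rw [← h0] at this
    simpa using this
  have hsum : ∑ i, intervalWeights N i * r i ^ 2 = 0 := by
    rw [← hs, hs0]; simp [chebPoly]
  have hw : ∀ i, ∀ z ∈ Set.Ioo (-1 : ℝ) 1, 0 < (intervalWeights N i).eval z := by
    intro i z hz
    obtain ⟨d, rfl | rfl⟩ := Nat.even_or_odd' N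
    · rw [intervalWeights_even]
      fin_cases i
      · simp
      · simp only [Fin.mk_one, cons_val_one, cons_val_fin_one, eval_sub, eval_one, eval_pow, eval_X]
        nlinarith [hz.1, hz.2]
    · rw [intervalWeights_odd]
      fin_cases i
      · simpa using hz.2
      · simp only [Fin.mk_one, cons_val_one, cons_val_fin_one, eval_add, eval_one, eval_X]
        linarith [hz.1]
  have hri : ∀ i, r i = 0 := by
    intro i
    refine eq_zero_of_infinite_isRoot _ ((Set.Ioo_infinite (show (-1 : ℝ) < 1 by norm_num)).mono ?_)
    intro z hz
    have h1 := congrArg (eval z) hsum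
    rw [eval_finsetSum, eval_zero] at h1
    have h2 := (Finset.sum_eq_zero_iff_of_nonneg fun j _ => by
      rw [eval_mul, eval_pow]
      exact mul_nonneg (hw j z hz).le (sq_nonneg _)).1 h1 i (Finset.mem_univ i)
    rw [eval_mul, eval_pow] at h2
    exact pow_eq_zero_iff (two_ne_zero) |>.1 ((mul_eq_zero.1 h2).resolve_left (hw i z hz).ne')
  funext ⟨i, j⟩
  have h1 : ∑ j, c ⟨i, j⟩ • p i j = 0 := Subtype.ext (hri i)
  exact Fintype.linearIndependent_iff.1 (p i).linearIndependent _ h1 j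

/-- By the trace comparison a small multiple of `oneVec` can be subtracted from `y` inside the dual
cone; adding it back absorbs any small perturbation. -/
theorem mem_interior_dualCone {y : Fin (N + 1) → ℝ} (hy : (intervalLam p y).PosDef) :
    y ∈ interior (dualCone (intervalCone N)) := by
  set G := intervalLam p (oneVec N) with hG_def
  have hG : G.PosSemidef := (intervalLam_oneVec_posDef p).posSemidef
  set τ := ((intervalLam p y)⁻¹ * G).trace
  have hsub := posSemidef_trace_inv_mul_smul_sub hy hG
  obtain ⟨c, hc, hmem⟩ : ∃ c : ℝ, 0 < c ∧ y - c • oneVec N ∈ dualCone (intervalCone N) := by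
    have hτ : 0 < |τ| + 1 := by positivity
    refine ⟨(|τ| + 1)⁻¹, inv_pos.2 hτ, (posSemidef_intervalLam_iff p _).1 ?_⟩
    have h1 : intervalLam p (y - (|τ| + 1)⁻¹ • oneVec N) = (|τ| + 1)⁻¹ •
        ((τ • intervalLam p y - G) + (|τ| + 1 - τ) • intervalLam p y) := by
      rw [map_sub, map_smul, ← hG_def, sub_add_eq_add_sub, ← add_smul, smul_sub, smul_smul]
      congr 1
      rw [show τ + (|τ| + 1 - τ) = |τ| + 1 by ring, inv_mul_cancel₀ hτ.ne', one_smul]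
    rw [h1]
    exact (hsub.add (hy.posSemidef.smul (by linarith [le_abs_self τ]))).smul (inv_pos.2 hτ).le
  rw [mem_interior_iff_mem_nhds, Metric.mem_nhds_iff]
  have hN : (0 : ℝ) < (N + 1) * 2 := by positivity
  refine ⟨c / ((N + 1) * 2), by positivity, fun z hz => ?_⟩
  have h1 := smul_oneVec_add_mem_dualCone (N := N) (e := z - y) (r := c / ((N + 1) * 2)) (c := c)
    (fun k => ?_) (le_of_eq (by field_simp))
  · have := dualCone_add_mem hmem h1
    rwa [show y - c • oneVec N + (c • oneVec N + (z - y)) = z by abel] at this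
  · rw [Metric.mem_ball, dist_eq_norm] at hz
    exact (norm_le_pi_norm (z - y) k).trans hz.le

theorem mul_le_dotProduct_of_sub_mem {t x : Fin (N + 1) → ℝ} {ε : ℝ}
    (ht : t - ε • oneVec N ∈ intervalCone N) (hx : x ∈ dualCone (intervalCone N)) :
    ε * x 0 ≤ t ⬝ᵥ x := by
  have := hx _ ht
  rw [sub_dotProduct, smul_dotProduct, single_dotProduct, one_mul, smul_eq_mul] at this
  linarith

/-- Every `t` in the interior of the cone is the negative gradient of the barrier function at some
point of the dual cone. -/
theorem exists_trace_inv_mul_eq {t : Fin (N + 1) → ℝ} {ε : ℝ} (hε : 0 < ε)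
    (ht : t - ε • oneVec N ∈ intervalCone N) :
    ∃ x, (intervalLam p x).PosDef ∧
      (∀ u, ((intervalLam p x)⁻¹ * intervalLam p u).trace = t ⬝ᵥ u) ∧ x 0 ≤ (N + 1) / ε := by
  set Λ := intervalLam p
  -- The slice is compact because `ε * x 0 ≤ t ⬝ᵥ x = 1` and `x 0` bounds every coordinate. A
  -- maximizer of `det Λ` on it satisfies the Lagrange condition.
  set K : Set (Fin (N + 1) → ℝ) := {x | x ∈ dualCone (intervalCone N) ∧ t ⬝ᵥ x = 1} with hK
  have hK0 : ∀ x ∈ K, x 0 ≤ 1 / ε := fun x hx => by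
    have := mul_le_dotProduct_of_sub_mem ht hx.1
    rw [hx.2] at this
    rw [le_div_iff₀ hε]
    linarith
  have hcompact : IsCompact K := by
    have hdot : Continuous fun x => t ⬝ᵥ x := by
      unfold dotProduct
      fun_prop
    have hclosed : IsClosed K := (isClosed_dualCone _).inter (isClosed_eq hdot continuous_const)
    refine (isCompact_univ_pi fun _ : Fin (N + 1) => isCompact_Icc).of_isClosed_subset
      (t := K) (s := Set.univ.pi fun _ => Set.Icc (-(1 / ε)) (1 / ε)) hclosed ?_
    intro x hx k _
    exact abs_le.1 ((abs_le_of_mem_dualCone hx.1 k).trans (hK0 x hx))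
  have ht0 : 0 < t 0 := by
    have := mul_le_dotProduct_of_sub_mem ht oneVec_mem_dualCone
    rw [dotProduct_single, mul_one, oneVec, Pi.single_eq_same, mul_one] at this
    linarith
  have hw : (t 0)⁻¹ • oneVec N ∈ K := by
    refine ⟨dualCone_smul_mem oneVec_mem_dualCone (inv_pos.2 ht0).le, ?_⟩
    rw [dotProduct_smul, dotProduct_single, mul_one, smul_eq_mul, inv_mul_cancel₀ ht0.ne']
  obtain ⟨x, hx, hmax⟩ := hcompact.exists_isMaxOn ⟨_, hw⟩
    (differentiable_det_linearMap Λ).continuous.continuousOn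
  have hdet : 0 < (Λ x).det := by
    refine lt_of_lt_of_le ?_ (hmax hw)
    change 0 < (Λ ((t 0)⁻¹ • oneVec N)).det
    rw [map_smul]
    exact ((intervalLam_oneVec_posDef p).smul (inv_pos.2 ht0)).det_pos
  have hpd : (Λ x).PosDef :=
    (PosSemidef.posDef_iff_det_ne_zero ((posSemidef_intervalLam_iff p x).2 hx.1)).2 hdet.ne'
  have hcrit : ∀ v, t ⬝ᵥ v = 0 → ((Λ x)⁻¹ * Λ v).trace = 0 := by
    intro v hv
    have hder := hasDerivAt_det_add_smul hdet.ne' (Λ v)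
    have hloc : IsLocalMax (fun r : ℝ => (Λ x + r • Λ v).det) 0 := by
      have hcont : Continuous fun r : ℝ => x + r • v := by fun_prop
      have hnhds : ∀ᶠ r in nhds (0 : ℝ), x + r • v ∈ interior (dualCone (intervalCone N)) := by
        refine hcont.continuousAt.eventually_mem (isOpen_interior.mem_nhds ?_)
        simpa using mem_interior_dualCone p hpd
      filter_upwards [hnhds] with r hr
      have hmem : x + r • v ∈ K := by
        refine ⟨interior_subset hr, ?_⟩
        rw [dotProduct_add, dotProduct_smul, hv, smul_zero, add_zero, hx.2]
      have := hmax hmem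
      simpa using this
    have := hloc.hasDerivAt_eq_zero hder
    exact (mul_eq_zero.1 this).resolve_left hdet.ne'
  have hN : (0 : ℝ) < N + 1 := by positivity
  have hunit := isUnit_iff_ne_zero.2 hdet.ne'
  -- At the maximizer the gradient functional is a multiple of `t`; evaluating at `x` gives `tr 1 =
  -- N + 1` against `t ⬝ᵥ x = 1`, so scaling by `N + 1` makes the multiple `1`.
  refine ⟨(N + 1 : ℝ) • x, ?_, fun u => ?_, ?_⟩
  · rw [map_smul]
    exact hpd.smul hN
  · have h1 := hcrit (u - (t ⬝ᵥ u) • x) (by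
      rw [dotProduct_sub, dotProduct_smul, hx.2, smul_eq_mul, mul_one, sub_self])
    have hinv : (Λ ((N + 1 : ℝ) • x))⁻¹ = (N + 1 : ℝ)⁻¹ • (Λ x)⁻¹ := by
      refine inv_eq_left_inv ?_
      rw [map_smul, smul_mul_smul_comm, inv_mul_cancel₀ hN.ne', one_smul, nonsing_inv_mul _ hunit]
    rw [map_sub, map_smul, mul_sub, trace_sub, mul_smul_comm, trace_smul, nonsing_inv_mul _ hunit,
      trace_one, card_sigma_intervalDims, smul_eq_mul, sub_eq_zero] at h1
    rw [hinv, smul_mul_assoc, trace_smul, h1, smul_eq_mul]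
    push_cast
    field_simp
  · rw [Pi.smul_apply, smul_eq_mul, div_eq_mul_one_div]
    exact mul_le_mul_of_nonneg_left (hK0 x hx) hN.le

end DualCone

/-! ### Rounding a scaled gradient point to an integer certificate. -/

section Certificates

open Matrix

variable {N : ℕ} (p : ∀ i : Fin 2, Module.Basis (Fin (intervalDims N i)) ℝ
  (degreeLT ℝ (intervalDims N i)))

theorem eval_chebPoly_pos_of_mem_interior {t : Fin (N + 1) → ℝ}
    (ht : t ∈ interior (intervalCone N)) {z : ℝ} (hz : z ∈ Set.Icc (-1 : ℝ) 1) :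
    0 < (chebPoly t).eval z := by
  have hcont : Continuous fun r : ℝ => t + r • (-oneVec N) := by fun_prop
  have hev : ∀ᶠ r in nhds (0 : ℝ), t + r • (-oneVec N) ∈ interior (intervalCone N) :=
    hcont.continuousAt.eventually_mem (isOpen_interior.mem_nhds (by simpa using ht))
  obtain ⟨r, hr, hr0⟩ := ((hev.filter_mono nhdsWithin_le_nhds).and
    (self_mem_nhdsWithin (s := Set.Ioi (0 : ℝ)))).exists
  have h := mem_intervalCone_iff_nonneg.1 (interior_subset hr) z hz
  have h1 : t + r • (-oneVec N) = t + Pi.single 0 (-r) := by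
    rw [smul_neg, ← Pi.single_smul, smul_eq_mul, mul_one, ← Pi.single_neg]
  rw [h1, chebPoly_add, chebPoly_single, eval_add] at h
  simp at h
  have hr0 : 0 < r := hr0
  linarith

theorem sub_smul_oneVec_mem_intervalCone {t : Fin (N + 1) → ℝ} {ε : ℝ}
    (h : ∀ z ∈ Set.Icc (-1 : ℝ) 1, ε ≤ (chebPoly t).eval z) :
    t - ε • oneVec N ∈ intervalCone N := by
  refine mem_intervalCone_iff_nonneg.2 fun z hz => ?_
  have h1 : t - ε • oneVec N = t + Pi.single 0 (-ε) := by
    rw [← Pi.single_smul, smul_eq_mul, mul_one, Pi.single_neg, sub_eq_add_neg]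
  rw [h1, chebPoly_add, chebPoly_single, eval_add]
  have := h z hz
  simp
  linarith

theorem isDualCertificate_of_posSemidef {s x : Fin (N + 1) → ℝ} (hs : s ∈ intervalCone N)
    (hx : (intervalLam p x).PosDef)
    (h : (intervalLam p ((hessian (barrier (intervalWeights N) p) x)⁻¹ *ᵥ s)).PosSemidef) :
    IsDualCertificate (intervalWeights N) p s x :=
  ⟨hs, mem_interior_dualCone p hx, (posSemidef_intervalLam_iff p _).1 h⟩

/-- A point close to a multiple of the point with negative gradient `t` is a dual certificate
of `t`. -/
theorem isDualCertificate_of_abs_sub_le {t x y : Fin (N + 1) → ℝ} (ht : t ∈ intervalCone N)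
    (ht0 : 0 < t 0) (hx : (intervalLam p x).PosDef)
    (hgrad : ∀ u, ((intervalLam p x)⁻¹ * intervalLam p u).trace = t ⬝ᵥ u)
    (hy : ∀ k, |y k - 4 * (N + 1) ^ 2 * t 0 * x k| ≤ 1 / 2) :
    IsDualCertificate (intervalWeights N) p t y := by
  set Λ := intervalLam p
  set n : ℝ := N + 1
  have hn1 : 1 ≤ n := by simp [n]
  have hn0 : 0 < n := by linarith
  -- The scale is chosen so that `tr (B⁻¹ * Λ 1) = t 0 / M = 1 / (4 n²)`, hence `n • Λ 1 ≤ β • B`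
  -- with `β = 1 / (4 n)`. Errors of at most `1 / 2` per coordinate are absorbed by `n • Λ 1`.
  set M : ℝ := 4 * n ^ 2 * t 0
  have hM : 0 < M := by positivity
  set B := Λ (M • x) with hB_def
  set A := Λ y with hA_def
  have hBM : B = M • Λ x := by rw [hB_def, map_smul]
  have hB : B.PosDef := by rw [hBM]; exact hx.smul hM
  have hBinv : B⁻¹ = M⁻¹ • (Λ x)⁻¹ := by
    refine inv_eq_left_inv ?_
    rw [hBM, smul_mul_smul_comm, inv_mul_cancel₀ hM.ne', one_smul,
      nonsing_inv_mul _ (isUnit_iff_ne_zero.2 hx.det_pos.ne')]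
  have htrB : ∀ u, (B⁻¹ * Λ u).trace = M⁻¹ * (t ⬝ᵥ u) := fun u => by
    rw [hBinv, smul_mul_assoc, trace_smul, hgrad, smul_eq_mul]
  set β : ℝ := 1 / (4 * n) with hβ
  have hβ0 : 0 < β := by positivity
  have hβ1 : β ≤ 1 / 4 := by
    rw [hβ, div_le_div_iff₀ (by positivity) (by positivity)]; linarith
  have hGB : (β • B - n • Λ (oneVec N)).PosSemidef := by
    have h1 := posSemidef_trace_inv_mul_smul_sub hB (intervalLam_oneVec_posDef p).posSemidef
    have h2 := h1.smul hn0.le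
    rw [htrB, dotProduct_single, mul_one, smul_sub, smul_smul] at h2
    convert h2 using 3
    simp only [M, β]
    field_simp
  have hAB : A - B = Λ (y - M • x) := by rw [map_sub]
  have hD : ∀ e : Fin (N + 1) → ℝ, (∀ k, |e k| ≤ 1 / 2) → (β • B + Λ e).PosSemidef := fun e he => by
    have h1 := (posSemidef_intervalLam_iff p _).2
      (smul_oneVec_add_mem_dualCone (c := n) he (by simp [n]))
    have h2 := hGB.add h1
    rw [map_add, map_smul] at h2
    rwa [← add_assoc, sub_add_cancel] at h2
  have hD1 : (β • B + (A - B)).PosSemidef := by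
    rw [hAB]
    exact hD _ fun k => by simpa using hy k
  have hD2 : (β • B - (A - B)).PosSemidef := by
    rw [hAB, sub_eq_add_neg, ← map_neg]
    exact hD _ fun k => by rw [Pi.neg_apply, abs_neg]; simpa using hy k
  have hA : A.PosDef := by
    have h1 : A = (1 - β) • B + (β • B + (A - B)) := by
      rw [sub_smul, one_smul]; abel
    rw [h1]
    exact (hB.smul (by linarith)).add_posSemidef hD1
  refine isDualCertificate_of_posSemidef p ht hA ?_
  set v := (hessian (barrier (intervalWeights N) p) y)⁻¹ *ᵥ t
  have hv : ∀ u, u ⬝ᵥ t = (A⁻¹ * Λ u * A⁻¹ * Λ v).trace :=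
    dotProduct_eq_trace_hessian_inv_mulVec Λ (intervalLam_isHermitian p) (intervalLam_injective p)
      hA t
  have hAinv' : A⁻¹ * A = 1 := nonsing_inv_mul _ (isUnit_iff_ne_zero.2 hA.det_pos.ne')
  -- The bounds on `A - B` relative to `β • B` are transferred to `2 β • A`, and `n * (2 β) = 1 / 2`
  -- is exactly what the Newton-type estimate allows.
  have hmain : (A + Λ (M⁻¹ • v - y)).PosSemidef := by
    refine posSemidef_add_of_trace_eq (κ := 2 * β) hA hB (intervalLam_isHermitian p _)
      (by linarith) ?_ ?_ ?_ ?_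
    · rw [card_sigma_intervalDims]
      push_cast
      change n * (2 * β) ≤ 1 / 2
      rw [hβ]
      apply le_of_eq
      field_simp
      norm_num
    · have h1 : (2 * β) • A - (A - B) =
          (1 - 2 * β) • (β • B - (A - B)) + (2 * β - (1 - 2 * β) * β) • B := by
        module
      rw [h1]
      exact (hD2.smul (by linarith)).add (hB.posSemidef.smul (by nlinarith))
    · have h1 : (2 * β) • A + (A - B) =
          (1 + 2 * β) • (β • B + (A - B)) + (2 * β - (1 + 2 * β) * β) • B := by
        module
      rw [h1]
      exact (hD1.smul (by linarith)).add (hB.posSemidef.smul (by nlinarith))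
    -- The Newton equation in direction `u` reads `tr (A⁻¹ Λu A⁻¹ Λv) = u ⬝ᵥ t = M tr (B⁻¹ Λu)`; it
    -- remains to substitute `Λu = M⁻¹ Λv - A` for one factor.
    · set u := M⁻¹ • v - y with hu
      have h1 : A⁻¹ * Λ u * A⁻¹ * Λ u = M⁻¹ • (A⁻¹ * Λ u * A⁻¹ * Λ v) - A⁻¹ * Λ u := by
        have hW : Λ u = M⁻¹ • Λ v - A := by rw [hu, map_sub, map_smul]
        calc A⁻¹ * Λ u * A⁻¹ * Λ u = A⁻¹ * Λ u * A⁻¹ * (M⁻¹ • Λ v - A) := by rw [← hW]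
          _ = _ := by rw [mul_sub, mul_smul_comm, mul_assoc (A⁻¹ * Λ u) A⁻¹ A, hAinv', mul_one]
      rw [h1, trace_sub, trace_smul, ← hv, htrB, dotProduct_comm, smul_eq_mul]
  have h2 : A + Λ (M⁻¹ • v - y) = M⁻¹ • Λ v := by
    rw [map_sub, map_smul]; abel
  rw [h2] at hmain
  have h3 := hmain.smul hM.le
  rwa [smul_smul, mul_inv_cancel₀ hM.ne', one_smul] at h3

/-- A positive polynomial has an integer dual certificate whose size is controlled by its constant
coefficient and its minimum. -/
theorem exists_int_isDualCertificate {t : Fin (N + 1) → ℝ} {ε : ℝ} (hε : 0 < ε)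
    (ht : t - ε • oneVec N ∈ intervalCone N) (htm : t ∈ intervalCone N) :
    ∃ y : Fin (N + 1) → ℤ, IsDualCertificate (intervalWeights N) p t (fun k => (y k : ℝ)) ∧
      ∀ k, |(y k : ℝ)| ≤ 4 * (N + 1) ^ 3 * t 0 / ε + 1 := by
  have ht0 : 0 < t 0 := by
    have := mul_le_dotProduct_of_sub_mem ht oneVec_mem_dualCone
    rw [dotProduct_single, mul_one, oneVec, Pi.single_eq_same, mul_one] at this
    linarith
  obtain ⟨x, hx, hgrad, hx0⟩ := exists_trace_inv_mul_eq p hε ht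
  have hround : ∀ a : ℝ, |(round a : ℝ) - a| ≤ 1 / 2 := fun a => by
    rw [abs_sub_comm]; exact abs_sub_round a
  refine ⟨fun k => round (4 * (N + 1) ^ 2 * t 0 * x k),
    isDualCertificate_of_abs_sub_le p htm ht0 hx hgrad fun k => hround _, fun k => ?_⟩
  have h1 := hround (4 * (N + 1) ^ 2 * t 0 * x k)
  have h2 := abs_le_of_mem_dualCone ((posSemidef_intervalLam_iff p x).1 hx.posSemidef) k
  have h3 : |4 * (N + 1) ^ 2 * t 0 * x k| ≤ 4 * (N + 1) ^ 3 * t 0 / ε := by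
    rw [abs_mul, abs_of_pos (by positivity)]
    calc 4 * ((N : ℝ) + 1) ^ 2 * t 0 * |x k| ≤ 4 * (N + 1) ^ 2 * t 0 * ((N + 1) / ε) :=
          mul_le_mul_of_nonneg_left (h2.trans hx0) (by positivity)
      _ = _ := by ring
  have h4 := abs_sub_abs_le_abs_sub ((round (4 * ((N : ℝ) + 1) ^ 2 * t 0 * x k) : ℤ) : ℝ)
    (4 * (N + 1) ^ 2 * t 0 * x k)
  linarith

end Certificates

/-! ### Degrees zero and one. -/

section SmallDegree

open Matrix

theorem isDualCertificate_oneVec_zero (p : ∀ i : Fin 2, Module.Basis (Fin (intervalDims 0 i)) ℝ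
    (degreeLT ℝ (intervalDims 0 i))) {t : Fin (0 + 1) → ℝ} (ht : t ∈ intervalCone 0) :
    IsDualCertificate (intervalWeights 0) p t (oneVec 0) := by
  have hG := intervalLam_oneVec_posDef p
  refine isDualCertificate_of_posSemidef p ht hG ?_
  have hv := dotProduct_eq_trace_hessian_inv_mulVec (intervalLam p) (intervalLam_isHermitian p)
    (intervalLam_injective p) hG t (oneVec 0)
  change oneVec 0 ⬝ᵥ t = (_ * intervalLam p ((hessian (barrier (intervalWeights 0) p) _)⁻¹ *ᵥ
    t)).trace at hv
  set v := (hessian (barrier (intervalWeights 0) p) (oneVec 0))⁻¹ *ᵥ t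
  have hdecomp : v = v 0 • oneVec 0 := by
    ext i
    fin_cases i
    simp
  have hunit := isUnit_iff_ne_zero.2 hG.det_pos.ne'
  rw [hdecomp, map_smul, nonsing_inv_mul _ hunit, one_mul, mul_smul_comm, nonsing_inv_mul _ hunit,
    trace_smul, trace_one, card_sigma_intervalDims, single_dotProduct] at hv
  have ht0 := abs_le_two_mul_of_mem_intervalCone ht 0
  have h0 : 0 ≤ v 0 := by
    have := abs_nonneg (t 0)
    simp at hv
    linarith
  rw [hdecomp, map_smul]
  exact hG.posSemidef.smul h0

theorem intervalDims_one (i : Fin 2) : intervalDims 1 i = 1 := by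
  have h := intervalDims_odd 0
  rw [show 2 * 0 + 1 = 1 from rfl] at h
  rw [h]
  fin_cases i <;> rfl

/-- All basis polynomials are constants here, and the functionals of `1` and of `T₁` take the values
`1, 1` and `-1, 1` on the weights `1 - z, 1 + z`. -/
theorem intervalLam_single_one (p : ∀ i : Fin 2, Module.Basis (Fin (intervalDims 1 i)) ℝ
    (degreeLT ℝ (intervalDims 1 i))) :
    intervalLam p (Pi.single 1 1) =
      intervalLam p (oneVec 1) * diagonal (fun a => if a.1 = 0 then -1 else 1) := by
  have hw : intervalWeights 1 = ![1 - X, 1 + X] := intervalWeights_odd 0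
  have h1 : ∀ x : Fin (1 + 1) → ℝ, chebFunctional x 1 = x 0 := fun x => by
    rw [← chebPoly_oneVec (N := 1), chebFunctional_chebPoly, single_one_dotProduct]
  have hX : ∀ x : Fin (1 + 1) → ℝ, chebFunctional x X = x 1 := fun x => by
    have : (X : ℝ[X]) = chebPoly (Pi.single (1 : Fin (1 + 1)) (1 : ℝ)) := by
      rw [chebPoly_single]; simp
    rw [this, chebFunctional_chebPoly, single_one_dotProduct]
  have hconst : ∀ i j, ∃ a : ℝ, ((p i j : degreeLT ℝ (intervalDims 1 i)) : ℝ[X]) = C a :=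
    fun i j => ⟨_, eq_C_of_natDegree_le_zero (natDegree_le_of_mem_degreeLT (n := 0)
      (degreeLT_mono (intervalDims_one i).le (p i j).2))⟩
  ext ⟨i, j⟩ ⟨i', k⟩
  rw [mul_diagonal, intervalLam_apply, intervalLam_apply, lam, lam]
  by_cases hi : i = i'
  · subst hi
    rw [blockDiagonal'_apply_eq, blockDiagonal'_apply_eq, lamBlock_apply, lamBlock_apply]
    obtain ⟨a, ha⟩ := hconst i j
    obtain ⟨b, hb⟩ := hconst i k
    have hsm : intervalWeights 1 i * (p i j : ℝ[X]) * (p i k : ℝ[X]) =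
        (a * b) • intervalWeights 1 i := by
      rw [ha, hb, smul_eq_C_mul, C_mul]; ring
    rw [hsm, map_smul, map_smul, hw]
    fin_cases i
    · simp [h1, hX]
    · simp [h1, hX]
  · rw [blockDiagonal'_apply_ne _ _ _ hi, blockDiagonal'_apply_ne _ _ _ hi, zero_mul]

/-- The Newton equation gives `H⁻¹ t = t / 2`. Elements of the cone satisfy `|s 1| ≤ s 0`, and two
such vectors have nonnegative dot product. -/
theorem isDualCertificate_oneVec_one (p : ∀ i : Fin 2, Module.Basis (Fin (intervalDims 1 i)) ℝ
    (degreeLT ℝ (intervalDims 1 i))) {t : Fin (1 + 1) → ℝ} (ht : t ∈ intervalCone 1) :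
    IsDualCertificate (intervalWeights 1) p t (oneVec 1) := by
  have hG := intervalLam_oneVec_posDef p
  refine isDualCertificate_of_posSemidef p ht hG ?_
  have hv : ∀ u, u ⬝ᵥ t = ((intervalLam p (oneVec 1))⁻¹ * intervalLam p u *
      (intervalLam p (oneVec 1))⁻¹ * intervalLam p
        ((hessian (barrier (intervalWeights 1) p) (oneVec 1))⁻¹ *ᵥ t)).trace :=
    dotProduct_eq_trace_hessian_inv_mulVec (intervalLam p) (intervalLam_isHermitian p)
      (intervalLam_injective p) hG t
  set v := (hessian (barrier (intervalWeights 1) p) (oneVec 1))⁻¹ *ᵥ t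
  set G := intervalLam p (oneVec 1)
  set S : Matrix (Σ i, Fin (intervalDims 1 i)) (Σ i, Fin (intervalDims 1 i)) ℝ :=
    diagonal (fun a => if a.1 = 0 then -1 else 1) with hS
  have hSS : S * S = 1 := by
    rw [hS, diagonal_mul_diagonal, ← diagonal_one]
    congr 1
    funext a
    split_ifs <;> norm_num
  have htrS : S.trace = 0 := by
    rw [hS, trace_diagonal, Fintype.sum_sigma, Fin.sum_univ_two]
    simp [intervalDims_one]
  have hunit := isUnit_iff_ne_zero.2 hG.det_pos.ne'
  have hdecomp : v = v 0 • oneVec 1 + v 1 • Pi.single 1 1 := by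
    ext i
    fin_cases i <;> simp
  have hGv : G⁻¹ * intervalLam p v = v 0 • 1 + v 1 • S := by
    conv_lhs => rw [hdecomp, map_add, map_smul, map_smul, intervalLam_single_one, mul_add,
      mul_smul_comm, mul_smul_comm, ← mul_assoc, nonsing_inv_mul _ hunit, one_mul]
  have hv0 := hv (oneVec 1)
  have hv1 := hv (Pi.single 1 1)
  rw [mul_assoc, hGv, nonsing_inv_mul _ hunit, one_mul, trace_add, trace_smul, trace_smul, htrS,
    trace_one, card_sigma_intervalDims, single_one_dotProduct] at hv0
  rw [mul_assoc, hGv, intervalLam_single_one, ← mul_assoc, nonsing_inv_mul _ hunit, one_mul,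
    mul_add, mul_smul_comm, mul_smul_comm, mul_one, hSS, trace_add, trace_smul, trace_smul, htrS,
    trace_one, card_sigma_intervalDims, single_one_dotProduct] at hv1
  simp only [smul_eq_mul, mul_zero, add_zero, zero_add] at hv0 hv1
  push_cast at hv0 hv1
  refine (posSemidef_intervalLam_iff p v).2 fun s hs => ?_
  have hcone : ∀ r ∈ intervalCone 1, |r 1| ≤ r 0 := fun r hr => by
    have h := mem_intervalCone_iff_nonneg.1 hr
    have h1 := h 1 (by norm_num)
    have h2 := h (-1) (by norm_num)
    simp [chebPoly, Fin.sum_univ_two] at h1 h2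
    rw [abs_le]
    constructor <;> linarith
  have hs' := abs_le.1 (hcone s hs)
  have ht' := abs_le.1 (hcone t ht)
  rw [dotProduct, Fin.sum_univ_two]
  nlinarith [mul_nonneg (by linarith : 0 ≤ s 0 - s 1) (by linarith : 0 ≤ t 0 - t 1),
    mul_nonneg (by linarith : 0 ≤ s 0 + s 1) (by linarith : 0 ≤ t 0 + t 1)]

end SmallDegree

/-! ### Bit sizes and the explicit exponent. -/

section BitSize

theorem abs_add_one_le_of_bitSize_le {a : ℤ} {τ : ℕ} (h : bitSize a ≤ τ) : |a| + 1 ≤ 2 ^ τ := by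
  have h1 : ⌈Real.logb 2 (|(a : ℝ)| + 1)⌉₊ ≤ τ := by unfold bitSize at h; omega
  rw [Nat.ceil_le, Real.logb_le_iff_le_rpow (by norm_num) (by positivity), Real.rpow_natCast] at h1
  exact_mod_cast h1

theorem bitSize_le_of_abs_add_one_le {a : ℤ} {m : ℕ} (h : |(a : ℝ)| + 1 ≤ 2 ^ m) :
    bitSize a ≤ m + 1 := by
  have h1 : ⌈Real.logb 2 (|(a : ℝ)| + 1)⌉₊ ≤ m := by
    rwa [Nat.ceil_le, Real.logb_le_iff_le_rpow (by norm_num) (by positivity), Real.rpow_natCast]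
  unfold bitSize
  omega

theorem logb_two_le_of_le_two_pow {x : ℝ} {m : ℕ} (hx : 0 ≤ x) (h : x ≤ 2 ^ m) :
    Real.logb 2 x ≤ m := by
  -- At `x = 0` the convention `Real.logb 2 0 = 0` makes the bound hold.
  rcases hx.eq_or_lt with rfl | hx
  · simp
  · rwa [Real.logb_le_iff_le_rpow (by norm_num) hx, Real.rpow_natCast]

theorem chebCoeffBound_two_pow_le {N τ : ℕ} (hN : 1 ≤ N) :
    chebCoeffBound N (2 ^ τ) ≤ 2 ^ (5 * N + τ) := by
  have h1 : (N + 2 : ℤ) ≤ 2 ^ (2 * N) := by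
    have : N + 1 < 2 ^ (N + 1) := Nat.lt_two_pow_self
    have h2 : 2 ^ (N + 1) ≤ 2 ^ (2 * N) := Nat.pow_le_pow_right (by norm_num) (by omega)
    exact_mod_cast (by omega : N + 2 ≤ 2 ^ (2 * N))
  have h2 : (N + 1 : ℤ) ≤ 2 ^ N := by exact_mod_cast Nat.lt_two_pow_self (n := N)
  have h3 : (3 ^ N : ℤ) ≤ 2 ^ (2 * N) := by
    rw [pow_mul]; exact pow_le_pow_left₀ (by norm_num) (by norm_num) N
  calc chebCoeffBound N (2 ^ τ) = (N + 2) * ((N + 1) * (2 ^ τ * 3 ^ N)) := rfl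
    _ ≤ 2 ^ (2 * N) * (2 ^ N * (2 ^ τ * 2 ^ (2 * N))) := by gcongr
    _ = 2 ^ (5 * N + τ) := by rw [← pow_add, ← pow_add, ← pow_add]; congr 1; ring

theorem factorial_mul_chebCoeffBound_pow_le {N τ : ℕ} (hN : 1 ≤ N) :
    ((2 * N).factorial : ℝ) * (chebCoeffBound N (2 ^ τ) : ℝ) ^ (2 * N) ≤
      2 ^ (14 * N ^ 2 + 2 * N * τ) := by
  have h1 : ((2 * N).factorial : ℝ) ≤ 2 ^ (4 * N ^ 2) := by
    have : (2 * N).factorial ≤ 2 ^ (4 * N ^ 2) := by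
      calc (2 * N).factorial ≤ (2 * N) ^ (2 * N) := Nat.factorial_le_pow _
        _ ≤ (2 ^ (2 * N)) ^ (2 * N) := Nat.pow_le_pow_left Nat.lt_two_pow_self.le _
        _ = 2 ^ (4 * N ^ 2) := by rw [← pow_mul]; congr 1; ring
    exact_mod_cast this
  have h2 : (chebCoeffBound N (2 ^ τ) : ℝ) ≤ 2 ^ (5 * N + τ) := by
    exact_mod_cast chebCoeffBound_two_pow_le hN
  have h0 : (0 : ℝ) ≤ chebCoeffBound N (2 ^ τ) := by
    unfold chebCoeffBound
    positivity
  calc ((2 * N).factorial : ℝ) * (chebCoeffBound N (2 ^ τ) : ℝ) ^ (2 * N)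
      ≤ 2 ^ (4 * N ^ 2) * (2 ^ (5 * N + τ)) ^ (2 * N) := by gcongr
    _ = 2 ^ (14 * N ^ 2 + 2 * N * τ) := by rw [← pow_mul, ← pow_add]; congr 1; ring

/-- An integer dual certificate of size at most `2 ^ O(N τ + N ^ 2)`. -/
theorem exists_int_isDualCertificate_le_two_pow {N τ : ℕ} (hN : 1 ≤ N)
    (p : ∀ i : Fin 2, Module.Basis (Fin (intervalDims N i)) ℝ (degreeLT ℝ (intervalDims N i)))
    {t : Fin (N + 1) → ℤ} (ht : (fun k => (t k : ℝ)) ∈ interior (intervalCone N))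
    (hτ : ∀ k, bitSize (t k) ≤ τ) :
    ∃ y : Fin (N + 1) → ℤ,
      IsDualCertificate (intervalWeights N) p (fun k => (t k : ℝ)) (fun k => (y k : ℝ)) ∧
      ∀ k, |(y k : ℝ)| + 1 ≤ 2 ^ (14 * N ^ 2 + 2 * N * τ + 3 * N + τ + 4) := by
  have hb : ∀ k, |t k| ≤ 2 ^ τ := fun k => by have := abs_add_one_le_of_bitSize_le (hτ k); omega
  set K : ℝ := (2 * N).factorial * (chebCoeffBound N (2 ^ τ) : ℝ) ^ (2 * N) with hK
  have hKpos : 0 < K := by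
    have : (0 : ℝ) < chebCoeffBound N (2 ^ τ) := by
      unfold chebCoeffBound
      positivity
    positivity
  have hlow := fun z (hz : z ∈ Set.Icc (-1 : ℝ) 1) => one_le_mul_eval_chebPoly hb
    (one_le_pow₀ (by norm_num)) (fun z hz => eval_chebPoly_pos_of_mem_interior ht hz) hz
  -- The lower bound `ε = 1 / K` for the minimum comes from the critical value estimate.
  obtain ⟨y, hy, hyb⟩ := exists_int_isDualCertificate p (t := fun k => (t k : ℝ)) (ε := 1 / K)
    (by positivity) (sub_smul_oneVec_mem_intervalCone fun z hz => by
      rw [div_le_iff₀ hKpos, mul_comm]; exact hlow z hz) (interior_subset ht)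
  refine ⟨y, hy, fun k => ?_⟩
  have h0 : (0 : ℝ) ≤ t 0 := by
    have := (abs_nonneg _).trans (abs_le_two_mul_of_mem_intervalCone (interior_subset ht) 0)
    linarith
  have h1 : (t 0 : ℝ) ≤ 2 ^ τ := by exact_mod_cast (le_abs_self _).trans (hb 0)
  have h2 : (N + 1 : ℝ) ≤ 2 ^ N := by exact_mod_cast Nat.lt_two_pow_self (n := N)
  have h3 : 4 * ((N : ℝ) + 1) ^ 3 * t 0 / (1 / K) ≤
      2 ^ (14 * N ^ 2 + 2 * N * τ + 3 * N + τ + 2) := by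
    rw [div_div_eq_mul_div, div_one]
    calc 4 * ((N : ℝ) + 1) ^ 3 * t 0 * K
        ≤ 4 * (2 ^ N) ^ 3 * 2 ^ τ * 2 ^ (14 * N ^ 2 + 2 * N * τ) := by
          gcongr
          exact factorial_mul_chebCoeffBound_pow_le hN
      _ = 2 ^ 2 * 2 ^ (N * 3) * 2 ^ τ * 2 ^ (14 * N ^ 2 + 2 * N * τ) := by
          rw [← pow_mul]; norm_num
      _ = _ := by rw [← pow_add, ← pow_add, ← pow_add]; congr 1; ring
  have h4 : (1 : ℝ) ≤ 2 ^ (14 * N ^ 2 + 2 * N * τ + 3 * N + τ + 2) :=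
    one_le_pow₀ (by norm_num)
  have h5 := hyb k
  have h6 : (2 : ℝ) ^ (14 * N ^ 2 + 2 * N * τ + 3 * N + τ + 4) =
      2 ^ (14 * N ^ 2 + 2 * N * τ + 3 * N + τ + 2) * 4 := by
    rw [pow_add _ _ 4, pow_add _ _ 2]; ring
  linarith

end BitSize

end DualCert

end

open DualCert in
theorem mainTheorem6 :
    ∃ C : ℝ, 0 < C ∧
      ∀ d N : ℕ, (N = 2 * d ∨ N = 2 * d + 1) →
      ∀ p : ∀ i : Fin 2, Module.Basis (Fin (intervalDims N i)) ℝ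
          (Polynomial.degreeLT ℝ (intervalDims N i)),
      ∀ (τ : ℕ) (t : Fin (N + 1) → ℤ),
        (fun k => (t k : ℝ)) ∈
            interior (wsosCone (intervalWeights N) (intervalDims N) (N + 1)) →
        (∀ k, bitSize (t k) ≤ τ) →
        ∃ y : Fin (N + 1) → ℤ,
          IsDualCertificate (intervalWeights N) p (fun k => (t k : ℝ)) (fun k => (y k : ℝ)) ∧
          Real.logb 2 ‖(fun k => (y k : ℝ))‖ ≤ C * (d * τ + d ^ 2) ∧
          (1 ≤ d → ∀ k, (bitSize (y k) : ℝ) ≤ C * (d * τ + d ^ 2)) := by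
  -- With `N ≤ 3 d` and `d ≥ 1` the exponent is at most `140 d² + 7 d τ`, so `200` is ample.
  refine ⟨200, by norm_num, fun d N hN p τ t ht hτ => ?_⟩
  rcases Nat.eq_zero_or_pos d with rfl | hd
  -- For `d = 0` the right-hand side is `0`; the vector `oneVec N` has norm `1`, whose logarithm is
  -- `0`.
  · have hcast : (fun k => (((Pi.single 0 1 : Fin (N + 1) → ℤ) k : ℤ) : ℝ)) = oneVec N := by
      funext k
      rcases eq_or_ne k 0 with rfl | hk
      · simp
      · simp [hk]
    refine ⟨Pi.single 0 1, ?_, ?_, fun h => absurd h (by norm_num)⟩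
    · rw [hcast]
      rcases hN with rfl | rfl
      · exact isDualCertificate_oneVec_zero p (interior_subset ht)
      · exact isDualCertificate_oneVec_one p (interior_subset ht)
    · rw [hcast, oneVec, Pi.norm_single]
      simp
  · obtain ⟨y, hy, hyb⟩ := exists_int_isDualCertificate_le_two_pow (by omega) p ht hτ
    have hτ1 : 1 ≤ τ := le_trans (by unfold bitSize; omega) (hτ 0)
    have hN3 : N ≤ 3 * d := by omega
    have hexp : 14 * N ^ 2 + 2 * N * τ + 3 * N + τ + 4 + 1 ≤ 200 * (d * τ + d ^ 2) := by
      have h1 : N ^ 2 ≤ (3 * d) ^ 2 := Nat.pow_le_pow_left hN3 2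
      have h2 : N * τ ≤ 3 * d * τ := Nat.mul_le_mul_right τ hN3
      have h3 : d ≤ d ^ 2 := Nat.le_self_pow two_ne_zero d
      have h4 : τ ≤ d * τ := Nat.le_mul_of_pos_left τ hd
      nlinarith
    have hexpR : ((14 * N ^ 2 + 2 * N * τ + 3 * N + τ + 4 + 1 : ℕ) : ℝ) ≤
        200 * (d * τ + d ^ 2) := by exact_mod_cast hexp
    refine ⟨y, hy, ?_, fun _ k => ?_⟩
    · refine (logb_two_le_of_le_two_pow (norm_nonneg _) ?_).trans
        ((Nat.cast_le.2 (Nat.le_succ _)).trans hexpR)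
      refine (pi_norm_le_iff_of_nonneg (by positivity)).2 fun k => ?_
      rw [Real.norm_eq_abs]
      linarith [hyb k]
    · exact (Nat.cast_le.2 (bitSize_le_of_abs_add_one_le (hyb k))).trans hexpR
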